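/- **The fourteen systems.** For each row of the table | $N$ | $a_1,a_2,a_3,a_4$ | $1/\mu$ | $\kappa$ | $c_2\cdot D$ | $\chi$ | |---|---|---|---|---|---| | 8 | 1/2, 1/2, 1/2, 1/2 | $2^8$ | 16 | 64 | −128 | | 9 | 1/4, 1/3, 2/3, 3/4 | $2^6 3^3$ | 6 | 48 | −156 | | 16 | 1/4, 1/2, 1/2, 3/4 | $2^{10}$ | 8 | 56 | −176 | | 25 | 1/5, 2/5, 3/5, 4/5 | $5^5$ | 5 | 50 | −200 | | 27 | 1/3, 1/3, 2/3, 2/3 | $3^6$ | 9 | 54 | −144 | | 32 | 1/4, 1/4, 3/4, 3/4 | $2^{12}$ | 4 | 40 | −144 | | 36 | 1/3, 1/2, 1/2, 2/3 | $2^4 3^3$ | 12 | 60 | −144 | | 72 | 1/6, 1/2, 1/2, 5/6 | $2^8 3^3$ | 4 | 52 | −256 | | 108 | 1/6, 1/3, 2/3, 5/6 | $2^4 3^6$ | 3 | 42 | −204 | | 128 | 1/8, 3/8, 5/8, 7/8 | $2^{16}$ | 2 | 44 | −296 | | 144 | 1/6, 1/4, 3/4, 5/6 | $2^{10} 3^3$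 | 2 | 32 | −156 | | 200 | 1/10, 3/10, 7/10, 9/10 | $2^8 5^5$ | 1 | 34 | −288 | | 216 | 1/6, 1/6, 5/6, 5/6 | $2^8 3^6$ | 1 | 22 | −120 | | 864 | 1/12, 5/12, 7/12, 11/12 | $2^{12} 3^6$ | 1 | 46 | −484 | let $L=\theta^4-\mu^{-1}z\prod_{k=1}^4(\theta+a_k)$ with $\theta=z\frac{d}{dz}$, and put $\sigma=(\kappa \bmod 2)/2$ and $\alpha=\frac34\bigl(\sum_i a_i-\sum_{i<j}a_ia_j\bigr)$. **The integral symplectic basis.** There are power series $f_0,f_1,f_2,f_3$, convergent for $|z|<\mu$, with $f_0(0)=1$ and $f_1(0)=f_2(0)=f_3(0)=0$, such that the components of $$\Pi_0=\begin{pmatrix} f_0\\ f_0\log z+f_1\\ \tfrac12 f_0\log^2 z+f_1\log z+f_2\\ \tfrac16 f_0\log^3 z+\tfrac12 f_1\log^2 z+f_2\log z+f_3\end{pmatrix}$$ are solutions of $Ly=0$ on $0<|z|<\mu$ (for every local branch of $\log z$). For any such series put $$\Pi=(2\pi i)^3\begin{pmatrix}\frac{\zeta(3)\chi}{(2\pi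 i)^3}&\frac{c_2\cdot D}{24\cdot 2\pi i}&0&\frac{\kappa}{(2\pi i)^3}\\ \frac{c_2\cdot D}{24}&\frac{\sigma}{2\pi i}&-\frac{\kappa}{(2\pi i)^2}&0\\ 1&0&0&0\\ 0&\frac1{2\pi i}&0&0\end{pmatrix}\Pi_0 .$$ **The conifold basis.** Let $\delta=1-z/\mu$. There are unique power series $g_0=1+O(\delta^3)$, $\nu=\delta+O(\delta^2)$, $g_2=\delta^2+O(\delta^3)$, $g_3=O(\delta^3)$ in $\delta$, convergent for $|\delta|<1$, such that the components of $$\Pi_\mu=\bigl(g_0,\ \nu,\ g_2,\ \nu\log\delta+g_3\bigr)^T$$ are solutions of $Ly=0$ on $0<|\delta|<1$ (for every local branch of $\log\delta$). Near every point with $0<|\delta|<1$, and for every branch of $\log\delta$ there, these components form a basis of the space of holomorphic solutions. **The quadratic relation.** Let $\gamma$ be any continuous path in $\mathbb C\setminus\{0,\mu\}$ from a point $p$ with $0<|p|<\mu$ to a point $q$ with $0<|1-q/\mu|<1$, and fix any branch of $\log z$ near $p$ and any branch of $\log\delta$ near $q$. Then there is exactly one matrix $T_\mu\in\mathbb C^{4\times4}$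 such that $\Pi$, formed near $p$ and continued analytically along $\gamma$, equals $T_\mu\Pi_\mu$ near $q$, and it satisfies $$T_\mu^T\begin{pmatrix}0&0&1&0\\0&0&0&1\\-1&0&0&0\\0&-1&0&0\end{pmatrix}T_\mu=(2\pi i)^3\begin{pmatrix}0&0&\frac\kappa2&0\\0&0&-\alpha\kappa&-\kappa\\-\frac\kappa2&\alpha\kappa&0&0\\0&\kappa&0&0\end{pmatrix}.$$ -/

import Mathlib

open Filter Topology Asymptotics

noncomputable section

namespace HypergeometricCY

/-- The numerical data of a one-parameter hypergeometric family of Calabi-Yau threefolds: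
the level `N`, the exponents `a₁, …, a₄`, the number `1/μ`, the triple intersection number
`κ = D³`, the number `c₂ · D` and the Euler number `χ` of the mirror. -/
structure Data where
  N : ℕ
  a : Fin 4 → ℚ
  muInv : ℕ
  kappa : ℤ
  c2D : ℤ
  chi : ℤ

/-- The fourteen hypergeometric families. -/
def table : List Data :=
  [⟨8, ![1/2, 1/2, 1/2, 1/2], 2^8, 16, 64, -128⟩,
   ⟨9, ![1/4, 1/3, 2/3, 3/4], 2^6 * 3^3, 6, 48, -156⟩,
   ⟨16, ![1/4, 1/2, 1/2, 3/4], 2^10, 8, 56, -176⟩,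
   ⟨25, ![1/5, 2/5, 3/5, 4/5], 5^5, 5, 50, -200⟩,
   ⟨27, ![1/3, 1/3, 2/3, 2/3], 3^6, 9, 54, -144⟩,
   ⟨32, ![1/4, 1/4, 3/4, 3/4], 2^12, 4, 40, -144⟩,
   ⟨36, ![1/3, 1/2, 1/2, 2/3], 2^4 * 3^3, 12, 60, -144⟩,
   ⟨72, ![1/6, 1/2, 1/2, 5/6], 2^8 * 3^3, 4, 52, -256⟩,
   ⟨108, ![1/6, 1/3, 2/3, 5/6], 2^4 * 3^6, 3, 42, -204⟩,
   ⟨128, ![1/8, 3/8, 5/8, 7/8], 2^16, 2, 44, -296⟩,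
   ⟨144, ![1/6, 1/4, 3/4, 5/6], 2^10 * 3^3, 2, 32, -156⟩,
   ⟨200, ![1/10, 3/10, 7/10, 9/10], 2^8 * 5^5, 1, 34, -288⟩,
   ⟨216, ![1/6, 1/6, 5/6, 5/6], 2^8 * 3^6, 1, 22, -120⟩,
   ⟨864, ![1/12, 5/12, 7/12, 11/12], 2^12 * 3^6, 1, 46, -484⟩]

/-- The conifold point `μ`. -/
def Data.mu (X : Data) : ℂ := 1 / (X.muInv : ℂ)

/-- `σ = (κ mod 2) / 2`. -/
def Data.sigma (X : Data) : ℂ := ((X.kappa % 2 : ℤ) : ℂ) / 2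

/-- `α = (3/4) (∑ aᵢ - ∑_{i<j} aᵢ aⱼ)`. -/
def Data.alpha (X : Data) : ℚ :=
  3 / 4 * (∑ i, X.a i - ∑ i, ∑ j ∈ Finset.Ioi i, X.a i * X.a j)

/-- The first-order operator `θ + c`, where `θ = z d/dz`. -/
def thetaAdd (c : ℂ) (y : ℂ → ℂ) : ℂ → ℂ := fun z => z * deriv y z + c * y z

/-- The hypergeometric operator `L = θ⁴ - μ⁻¹ z ∏ₖ (θ + aₖ)`. -/
def Data.L (X : Data) (y : ℂ → ℂ) : ℂ → ℂ := fun z =>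
  ((thetaAdd 0)^[4] y) z -
    X.mu⁻¹ * z * thetaAdd (X.a 0) (thetaAdd (X.a 1) (thetaAdd (X.a 2) (thetaAdd (X.a 3) y))) z

/-- `y` is a holomorphic solution of `L y = 0` in a neighbourhood of `p`. -/
def Data.IsSolutionAt (X : Data) (y : ℂ → ℂ) (p : ℂ) : Prop :=
  AnalyticAt ℂ y p ∧ ∀ᶠ z in 𝓝 p, X.L y z = 0

/-- The components of `Y` form, near `p`, a basis of the space of local holomorphic solutions of
`L y = 0` (germs at `p`). -/
def Data.IsSolutionBasisAt (X : Data) (Y : ℂ → Fin 4 → ℂ) (p : ℂ) : Prop :=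
  (∀ i, X.IsSolutionAt (fun z => Y z i) p) ∧
    ∀ y, X.IsSolutionAt y p → ∃! c : Fin 4 → ℂ, y =ᶠ[𝓝 p] fun z => ∑ i, c i * Y z i

/-- For `p ≠ 0` and `exp ℓ = p`, this is, near `w = p`, the branch of `log w` that takes the
value `ℓ` at `w = p`.  Every branch of the logarithm near `p` is of this form. -/
def logBranch (p ℓ w : ℂ) : ℂ := ℓ + Complex.log (w / p)

/-- The vector `Π₀`, with `lam` a branch of `log z`. -/
def mumVector (f : Fin 4 → ℂ → ℂ) (lam : ℂ → ℂ) (z : ℂ) : Fin 4 → ℂ :=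
  ![f 0 z,
    f 0 z * lam z + f 1 z,
    1 / 2 * f 0 z * lam z ^ 2 + f 1 z * lam z + f 2 z,
    1 / 6 * f 0 z * lam z ^ 3 + 1 / 2 * f 1 z * lam z ^ 2 + f 2 z * lam z + f 3 z]

/-- The power series `f₀, …, f₃` (convergent for `|z| < |μ|`) of the Frobenius basis `Π₀` at the
point `z = 0` of maximal unipotent monodromy. -/
structure Data.IsMUMFrobenius (X : Data) (f : Fin 4 → ℂ → ℂ) : Prop where
  analytic : ∀ j, AnalyticOnNhd ℂ (f j) (Metric.ball 0 ‖X.mu‖)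
  f_zero : f 0 0 = 1
  f_one : f 1 0 = 0
  f_two : f 2 0 = 0
  f_three : f 3 0 = 0
  solution : ∀ p ℓ : ℂ, 0 < ‖p‖ → ‖p‖ < ‖X.mu‖ → Complex.exp ℓ = p →
    ∀ i, X.IsSolutionAt (fun z => mumVector f (logBranch p ℓ) z i) p

/-- The matrix that takes `Π₀` to the integral symplectic basis `Π`. -/
def Data.integralMatrix (X : Data) : Matrix (Fin 4) (Fin 4) ℂ :=
  let w : ℂ := 2 * Real.pi * Complex.I
  w ^ 3 • !![riemannZeta 3 * X.chi / w ^ 3, X.c2D / (24 * w), 0, X.kappa / w ^ 3;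
             X.c2D / 24, X.sigma / w, -X.kappa / w ^ 2, 0;
             1, 0, 0, 0;
             0, 1 / w, 0, 0]

/-- The integral symplectic basis `Π = (F₀, F₁, X⁰, X¹)`, with `lam` a branch of `log z`. -/
def Data.integralVector (X : Data) (f : Fin 4 → ℂ → ℂ) (lam : ℂ → ℂ) (z : ℂ) : Fin 4 → ℂ :=
  X.integralMatrix.mulVec (mumVector f lam z)

/-- The conifold variable `δ = 1 - z/μ`. -/
def Data.delta (X : Data) (z : ℂ) : ℂ := 1 - z / X.mu

/-- The vector `Π_μ = (g₀(δ), g₁(δ), g₂(δ), g₁(δ) log δ + g₃(δ))`, where `g₁ = ν` and `lam` is a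
branch of the logarithm near the values of `δ` in question. -/
def Data.conifoldVector (X : Data) (g : Fin 4 → ℂ → ℂ) (lam : ℂ → ℂ) (z : ℂ) : Fin 4 → ℂ :=
  ![g 0 (X.delta z), g 1 (X.delta z), g 2 (X.delta z),
    g 1 (X.delta z) * lam (X.delta z) + g 3 (X.delta z)]

/-- The power series `g₀ = 1 + O(δ³)`, `g₁ = ν = δ + O(δ²)`, `g₂ = δ² + O(δ³)`, `g₃ = O(δ³)`
(convergent for `|δ| < 1`) of the normalized Frobenius basis `Π_μ` at the conifold point. -/
structure Data.IsConifoldFrobenius (X : Data) (g : Fin 4 → ℂ → ℂ) : Prop where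
  analytic : ∀ j, AnalyticOnNhd ℂ (g j) (Metric.ball 0 1)
  g_zero : (fun d => g 0 d - 1) =O[𝓝 0] fun d : ℂ => d ^ 3
  g_one : (fun d => g 1 d - d) =O[𝓝 0] fun d : ℂ => d ^ 2
  g_two : (fun d => g 2 d - d ^ 2) =O[𝓝 0] fun d : ℂ => d ^ 3
  g_three : (fun d => g 3 d) =O[𝓝 0] fun d : ℂ => d ^ 3
  solution : ∀ p ℓ : ℂ, 0 < ‖X.delta p‖ → ‖X.delta p‖ < 1 → Complex.exp ℓ = X.delta p →
    ∀ i, X.IsSolutionAt (fun z => X.conifoldVector g (logBranch (X.delta p) ℓ) z i) p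

/-- `F` is an analytic continuation along the path `γ`: a family of germs of vector valued
holomorphic functions, `F t` at the point `γ t`, locally constant in `t` up to direct
continuation. -/
structure IsAnalyticContinuation {p q : ℂ} (γ : Path p q)
    (F : unitInterval → ℂ → Fin 4 → ℂ) : Prop where
  analytic : ∀ t, AnalyticAt ℂ (F t) (γ t)
  compatible : ∀ t, ∀ᶠ s in 𝓝 t, F s =ᶠ[𝓝 (γ s)] F t

/-- `T` is the transition matrix from `Π_μ` to `Π` along the path `γ` from `p` (near `0`) to `q`
(near `μ`): the analytic continuation along `γ` of `Π`, formed at `p` with the branch of `log z`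
of value `ℓ₀`, equals `T Π_μ` near `q`, where `Π_μ` is formed with the branch of `log δ` of value
`ℓ₁` at `q`. -/
def Data.IsTransitionMatrix (X : Data) (f g : Fin 4 → ℂ → ℂ) {p q : ℂ} (γ : Path p q)
    (ℓ₀ ℓ₁ : ℂ) (T : Matrix (Fin 4) (Fin 4) ℂ) : Prop :=
  ∃ F : unitInterval → ℂ → Fin 4 → ℂ, IsAnalyticContinuation γ F ∧
    F 0 =ᶠ[𝓝 p] X.integralVector f (logBranch p ℓ₀) ∧
    F 1 =ᶠ[𝓝 q] fun z => T.mulVec (X.conifoldVector g (logBranch (X.delta q) ℓ₁) z)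

/-- The standard symplectic form `Σ`. -/
def sympl : Matrix (Fin 4) (Fin 4) ℂ :=
  !![0, 0, 1, 0;
     0, 0, 0, 1;
     -1, 0, 0, 0;
     0, -1, 0, 0]

/-- The intersection form in the basis `Π_μ`. -/
def Data.conifoldForm (X : Data) : Matrix (Fin 4) (Fin 4) ℂ :=
  let k : ℂ := X.kappa
  let α : ℂ := X.alpha
  (2 * Real.pi * Complex.I) ^ 3 •
    !![0, 0, k / 2, 0;
       0, 0, -(α * k), -k;
       -(k / 2), α * k, 0, 0;
       0, k, 0, 0]

end HypergeometricCY

end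

/-! The exponents of each family are symmetric under a ↦ 1 - a, so their elementary symmetric
functions satisfy e₁ = 2 and e₃ = e₂ - 1, and the operator is self-dual. Hence the jets (y, θy, θ²y,
θ³y) carry an alternating form, polynomial in t = z / μ and nondegenerate for t ≠ 1, whose value on
any two solutions is constant (`companion_pairing`). Apart from this, the proof needs only μ ≠ 0 and
κ ≠ 0.

A constant form survives analytic continuation, so its Gram matrix can be computed at either end of
the path. Near z = 0, Π₀ is the first row of F(z) exp(N log z) with F(0) = 1 and N the nilpotent
residue, and its Gram matrix is the form at t = 0 (`exists_mum`). The integral matrix turns this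
into -κ (2πi)³ Σ; the terms with c₂ · D, σ and ζ(3)χ drop out (`integralMatrix_form`). At the
conifold the jets have poles, but a gauge transformation makes the residue nilpotent and extends the
form over δ = 0, where the Gram matrix W of Π_μ is read off from initial values (`exists_conifold`).
If Π = T Π_μ, comparison gives T W Tᵀ = -κ (2πi)³ Σ, and inversion gives Tᵀ Σ T = κ (2πi)³ W⁻¹, the
asserted matrix (`quadratic_of_gram`, `conifoldForm_eq`).

Existence at both points is Frobenius' method for matrix systems (`exists_frobenius_solution`); its
case of zero residue gives fundamental systems at ordinary points, hence continuation along paths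
(`exists_jet_continuation`). Nondegeneracy of the form replaces Wronskians and dimension counts:
coefficients of one system of solutions in another are quotients of Gram matrices
(`Data.IsJetAt.exists_eq_mul`). Uniqueness of the normalized series is an asymptotic comparison in
the logarithmic coordinate, as its real part tends to -∞ (`mum_unique`, `conifold_unique`). -/

noncomputable section

namespace HypergeometricCY

/-! ### Power series solutions of singular matrix systems with nilpotent residue -/

section Frobenius

/-- A discrete Gronwall bound: the partial sums satisfy S (n + 1) ≤ (1 + K / n) S n for large n, so
S n * q ^ n shrinks at each step by a factor bounded by (1 + K / n) q, which tends to q < 1. -/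
lemma summable_of_mul_le_sum {v : ℕ → ℝ} (hv : ∀ n, 0 ≤ v n) {K : ℝ} {n₀ : ℕ}
    (h : ∀ n ≥ n₀, n * v n ≤ K * ∑ k ∈ Finset.range n, v k) {q : ℝ} (hq0 : 0 < q) (hq1 : q < 1) :
    Summable fun n => v n * q ^ n := by
  set S : ℕ → ℝ := fun n => ∑ k ∈ Finset.range n, v k with hS
  have hS0 : ∀ n, 0 ≤ S n := fun n => Finset.sum_nonneg fun k _ => hv k
  have hsucc : ∀ n, S (n + 1) = S n + v n := fun n => Finset.sum_range_succ v n
  have hsum : Summable fun n => S n * q ^ n := by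
    refine summable_of_ratio_norm_eventually_le (r := (1 + q) / 2) (by linarith) ?_
    -- Beyond n₁ one has K q / n ≤ (1 - q) / 2, and q + (1 - q) / 2 = (1 + q) / 2.
    obtain ⟨n₁, hn₁⟩ := exists_nat_gt (max 0 (K * q / ((1 - q) / 2)))
    filter_upwards [eventually_ge_atTop (max n₀ n₁)] with n hn
    have hn0 : n₀ ≤ n := le_trans (le_max_left _ _) hn
    have hn1 : (n₁ : ℝ) ≤ n := by exact_mod_cast le_trans (le_max_right _ _) hn
    have hnpos : (0 : ℝ) < n := lt_of_lt_of_le (lt_of_le_of_lt (le_max_left _ _) hn₁) hn1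
    have hKn : K * q / ((1 - q) / 2) ≤ n :=
      ((le_max_right _ _).trans hn₁.le).trans hn1
    rw [div_le_iff₀ (by linarith)] at hKn
    rw [Real.norm_of_nonneg (mul_nonneg (hS0 _) (by positivity)),
      Real.norm_of_nonneg (mul_nonneg (hS0 _) (by positivity)), hsucc, pow_succ]
    have hstep : (S n + v n) * q ≤ (1 + q) / 2 * S n := by
      have h1 := h n hn0
      have h2 : n * (v n * q) ≤ n * ((1 - q) / 2 * S n) := by
        calc n * (v n * q) = (n * v n) * q := by ring
          _ ≤ (K * S n) * q := by gcongr
          _ = (K * q) * S n := by ring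
          _ ≤ (n * ((1 - q) / 2)) * S n := by gcongr; exact hS0 n
          _ = _ := by ring
      have h3 := le_of_mul_le_mul_left h2 hnpos
      linarith
    calc (S n + v n) * (q ^ n * q) = ((S n + v n) * q) * q ^ n := by ring
      _ ≤ ((1 + q) / 2 * S n) * q ^ n := by gcongr
      _ = _ := by ring
  have hsum' : Summable fun n => q⁻¹ * (S (n + 1) * q ^ (n + 1)) :=
    ((summable_nat_add_iff 1).2 hsum).mul_left _
  refine Summable.of_nonneg_of_le (fun n => mul_nonneg (hv n) (by positivity)) (fun n => ?_) hsum'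
  have : q⁻¹ * (S (n + 1) * q ^ (n + 1)) = S (n + 1) * q ^ n := by
    rw [pow_succ]; field_simp
  rw [this, hsucc]
  have := hS0 n
  gcongr
  linarith

variable {𝔸 : Type*} [NormedRing 𝔸] [NormedAlgebra ℂ 𝔸]

/-- Left multiplication by `a` and right multiplication by `b` commute and are nilpotent, so their
difference is nilpotent, and a nonzero scalar minus a nilpotent operator is invertible. Nilpotent
residues thus exclude resonances in the Frobenius recursion. -/
lemma exists_sylvester_solution {a b : 𝔸} (ha : IsNilpotent a) (hb : IsNilpotent b) {n : ℕ}
    (hn : n ≠ 0) (y : 𝔸) : ∃ c : 𝔸, (n : ℂ) • c = a * c - c * b + y := by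
  set T : Module.End ℂ 𝔸 := LinearMap.mulLeft ℂ a - LinearMap.mulRight ℂ b with hT
  have hTn : IsNilpotent T :=
    Commute.isNilpotent_sub (LinearMap.commute_mulLeft_right a b)
      ((LinearMap.isNilpotent_mulLeft_iff ℂ a).2 ha)
      ((LinearMap.isNilpotent_mulRight_iff ℂ b).2 hb)
  have hu : IsUnit (algebraMap ℂ (Module.End ℂ 𝔸) n + -T) :=
    hTn.neg.isUnit_add_left_of_commute
      ((IsUnit.mk0 (n : ℂ) (by exact_mod_cast hn)).map (algebraMap ℂ (Module.End ℂ 𝔸)))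
      (Algebra.commutes _ _).symm
  obtain ⟨c, hc⟩ := ((Module.End.isUnit_iff _).1 hu).2 y
  refine ⟨c, ?_⟩
  rw [← hc]
  have h1 : (algebraMap ℂ (Module.End ℂ 𝔸) n) c = (n : ℂ) • c := Module.algebraMap_end_apply _ _ _ _ _
  rw [LinearMap.add_apply, h1]
  simp only [hT, LinearMap.neg_apply, LinearMap.sub_apply, LinearMap.mulLeft_apply,
    LinearMap.mulRight_apply]
  abel

/-- The coefficients obtained by solving a recursion with the solution operators `sol n`. -/
def recursionCoeff (a : ℕ → 𝔸) (sol : ℕ → 𝔸 → 𝔸) (n : ℕ) : 𝔸 :=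
  sol n (∑ k : Fin n, a (n - k) * recursionCoeff a sol k)
decreasing_by exact k.2

/-- Comparing coefficients of xⁿ in x F' = A F - F b gives a Sylvester equation for `c n`, with the
earlier coefficients as inhomogeneity. For n = 0 it is the compatibility condition `h₀`. -/
lemma exists_frobenius_coeff (a : ℕ → 𝔸) {b c₀ : 𝔸} (ha : IsNilpotent (a 0)) (hb : IsNilpotent b)
    (h₀ : a 0 * c₀ = c₀ * b) :
    ∃ c : ℕ → 𝔸, c 0 = c₀ ∧
      ∀ n : ℕ, (n : ℂ) • c n = ∑ k ∈ Finset.range (n + 1), a k * c (n - k) - c n * b := by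
  have hsol : ∃ sol : ℕ → 𝔸 → 𝔸, (∀ y, sol 0 y = c₀) ∧
      ∀ n : ℕ, n ≠ 0 → ∀ y, (n : ℂ) • sol n y = a 0 * sol n y - sol n y * b + y := by
    -- At n = 0 the Sylvester operator is nilpotent, not invertible; the prescribed constant term is
    -- returned whatever the inhomogeneity.
    refine ⟨fun n y => if h : n = 0 then c₀ else
      (exists_sylvester_solution ha hb h y).choose, fun y => by simp, fun n hn y => ?_⟩
    simp only [hn, dite_false]
    exact (exists_sylvester_solution ha hb hn y).choose_spec
  obtain ⟨sol, h0, hs⟩ := hsol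
  have hc0 : recursionCoeff a sol 0 = c₀ := by rw [recursionCoeff, h0]
  refine ⟨recursionCoeff a sol, hc0, fun n => ?_⟩
  rcases eq_or_ne n 0 with rfl | hn
  · simp [hc0, h₀]
  · have hsum : ∑ k : Fin n, a (n - k) * recursionCoeff a sol k =
        ∑ k ∈ Finset.range n, a (k + 1) * recursionCoeff a sol (n - (k + 1)) := by
      rw [Fin.sum_univ_eq_sum_range (fun k => a (n - k) * recursionCoeff a sol k) n,
        ← Finset.sum_range_reflect]
      refine Finset.sum_congr rfl fun k hk => ?_
      have := Finset.mem_range.1 hk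
      congr 2 <;> omega
    have h1 := hs n hn (∑ k : Fin n, a (n - k) * recursionCoeff a sol k)
    have e : recursionCoeff a sol n = sol n (∑ k : Fin n, a (n - k) * recursionCoeff a sol k) := by
      rw [recursionCoeff]
    rw [← e, hsum] at h1
    rw [h1, Finset.sum_range_succ']
    simp only [Nat.sub_zero]
    abel

lemma exists_norm_mul_pow_le {a : ℕ → 𝔸} {y : 𝔸} {s : ℝ} (hs : 0 ≤ s)
    (h : HasSum (fun k => (s : ℂ) ^ k • a k) y) : ∃ K, 0 ≤ K ∧ ∀ k, ‖a k‖ * s ^ k ≤ K := by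
  have h1 := h.summable.tendsto_atTop_zero.norm
  obtain ⟨K, hK⟩ := h1.bddAbove_range
  have hb : ∀ k, ‖a k‖ * s ^ k ≤ K := fun k => by
    have := hK ⟨k, rfl⟩
    simpa [norm_smul, abs_of_nonneg hs, mul_comm] using this
  exact ⟨K, le_trans (by positivity) (hb 0), hb⟩

/-- For n ≥ 2 (‖a 0‖ + ‖b‖) the terms a 0 * c n and c n * b are absorbed by half of n ‖c n‖.
Convergence at an intermediate radius s gives ‖a k‖ s ^ k ≤ K, so the numbers ‖c n‖ s ^ n satisfy
the hypothesis of `summable_of_mul_le_sum` with constant 2 K, and q = ρ / s. -/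
lemma summable_norm_frobenius_coeff {a c : ℕ → 𝔸} {b : 𝔸}
    (hc : ∀ n : ℕ, (n : ℂ) • c n = ∑ k ∈ Finset.range (n + 1), a k * c (n - k) - c n * b)
    {r : ℝ} {A : ℂ → 𝔸}
    (hA : ∀ x ∈ Metric.ball (0 : ℂ) r, HasSum (fun k => x ^ k • a k) (A x))
    {ρ : ℝ} (hρ : 0 < ρ) (hρr : ρ < r) : Summable fun n => ‖c n‖ * ρ ^ n := by
  obtain ⟨s, hρs, hsr⟩ := exists_between hρr
  have hs : 0 < s := hρ.trans hρs
  obtain ⟨K, hK0, hK⟩ := exists_norm_mul_pow_le hs.le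
    (hA s (by simpa [abs_of_pos hs] using hsr))
  obtain ⟨n₀, hn₀⟩ := exists_nat_gt (2 * (‖a 0‖ + ‖b‖))
  have key : Summable fun n => (‖c n‖ * s ^ n) * (ρ / s) ^ n := by
    refine summable_of_mul_le_sum (fun n => by positivity) (K := 2 * K) (n₀ := n₀)
      (fun n hn => ?_) (by positivity) ((div_lt_one hs).2 hρs)
    have hn' : 2 * (‖a 0‖ + ‖b‖) ≤ n := hn₀.le.trans (by exact_mod_cast hn)
    have h1 : (n : ℝ) * ‖c n‖ ≤
        ∑ k ∈ Finset.range n, ‖a (k + 1)‖ * ‖c (n - (k + 1))‖ + (‖a 0‖ + ‖b‖) * ‖c n‖ := by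
      calc (n : ℝ) * ‖c n‖ = ‖(n : ℂ) • c n‖ := by rw [norm_smul]; simp
        _ = ‖∑ k ∈ Finset.range n, a (k + 1) * c (n - (k + 1)) + (a 0 * c n - c n * b)‖ := by
          rw [hc n, Finset.sum_range_succ']
          simp only [Nat.sub_zero, add_sub_assoc]
        _ ≤ ∑ k ∈ Finset.range n, ‖a (k + 1)‖ * ‖c (n - (k + 1))‖ +
            (‖a 0‖ * ‖c n‖ + ‖c n‖ * ‖b‖) := by
          refine (norm_add_le _ _).trans (add_le_add ?_ ?_)
          · exact (norm_sum_le _ _).trans (Finset.sum_le_sum fun k _ => norm_mul_le _ _)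
          · exact (norm_sub_le _ _).trans (add_le_add (norm_mul_le _ _) (norm_mul_le _ _))
        _ = _ := by ring
    have h2 : (n : ℝ) * ‖c n‖ ≤
        2 * ∑ k ∈ Finset.range n, ‖a (k + 1)‖ * ‖c (n - (k + 1))‖ := by
      have := mul_le_mul_of_nonneg_right hn' (norm_nonneg (c n))
      linarith
    have h3 : (∑ k ∈ Finset.range n, ‖a (k + 1)‖ * ‖c (n - (k + 1))‖) * s ^ n ≤
        K * ∑ k ∈ Finset.range n, ‖c k‖ * s ^ k := by
      rw [Finset.sum_mul, ← Finset.sum_range_reflect (fun k => ‖c k‖ * s ^ k), Finset.mul_sum]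
      refine Finset.sum_le_sum fun k hk => ?_
      have hk' := Finset.mem_range.1 hk
      have e1 : n - 1 - k = n - (k + 1) := by omega
      have e2 : s ^ n = s ^ (k + 1) * s ^ (n - (k + 1)) := by
        rw [← pow_add]; congr 1; omega
      rw [e1, e2]
      calc ‖a (k + 1)‖ * ‖c (n - (k + 1))‖ * (s ^ (k + 1) * s ^ (n - (k + 1)))
          = (‖a (k + 1)‖ * s ^ (k + 1)) * (‖c (n - (k + 1))‖ * s ^ (n - (k + 1))) := by ring
        _ ≤ _ := by gcongr; exact hK _
    calc (n : ℝ) * (‖c n‖ * s ^ n) = (n * ‖c n‖) * s ^ n := by ring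
      _ ≤ (2 * ∑ k ∈ Finset.range n, ‖a (k + 1)‖ * ‖c (n - (k + 1))‖) * s ^ n := by gcongr
      _ = 2 * ((∑ k ∈ Finset.range n, ‖a (k + 1)‖ * ‖c (n - (k + 1))‖) * s ^ n) := by ring
      _ ≤ 2 * (K * ∑ k ∈ Finset.range n, ‖c k‖ * s ^ k) := by gcongr
      _ = _ := by ring
  refine key.congr fun n => ?_
  rw [div_pow]
  field_simp

variable [CompleteSpace 𝔸]

/-- Termwise differentiation of a power series on its disc of convergence. -/
lemma hasDerivAt_powerSeries {c : ℕ → 𝔸} {r : ℝ}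
    (hc : ∀ ρ : ℝ, 0 < ρ → ρ < r → Summable fun n => ‖c n‖ * ρ ^ n) {x : ℂ}
    (hx : x ∈ Metric.ball (0 : ℂ) r) :
    HasDerivAt (fun x : ℂ => ∑' n, x ^ n • c n) (∑' n : ℕ, ((n : ℂ) * x ^ (n - 1)) • c n) x := by
  have hxr : ‖x‖ < r := by simpa using hx
  obtain ⟨ρ, hxρ, hρr⟩ := exists_between hxr
  obtain ⟨s, hρs, hsr⟩ := exists_between hρr
  have hρ : 0 < ρ := (norm_nonneg x).trans_lt hxρ
  have hs : 0 < s := hρ.trans hρs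
  have hu : Summable fun n : ℕ => n * ρ ^ (n - 1) * ‖c n‖ := by
    obtain ⟨K, hK⟩ := (hc s hs hsr).tendsto_atTop_zero.bddAbove_range
    have hK' : ∀ n, ‖c n‖ * s ^ n ≤ K := fun n => hK ⟨n, rfl⟩
    have hq : ‖ρ / s‖ < 1 := by
      rw [Real.norm_of_nonneg (by positivity)]; exact (div_lt_one hs).2 hρs
    have hgeo : Summable fun n : ℕ => K * ρ⁻¹ * ((n : ℝ) ^ 1 * (ρ / s) ^ n) :=
      (summable_pow_mul_geometric_of_norm_lt_one 1 hq).mul_left _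
    refine Summable.of_nonneg_of_le (fun n => by positivity) (fun n => ?_) hgeo
    have e : n * ρ ^ (n - 1) * ‖c n‖ =
        (‖c n‖ * s ^ n) * (ρ⁻¹ * ((n : ℝ) ^ 1 * (ρ / s) ^ n)) := by
      rcases n with _ | n
      · simp
      · rw [Nat.add_sub_cancel, div_pow, pow_one, pow_succ ρ n]
        field_simp
    rw [e, mul_assoc K]
    exact mul_le_mul_of_nonneg_right (hK' n) (by positivity)
  refine hasDerivAt_tsum_of_isPreconnected (t := Metric.ball (0 : ℂ) ρ) (y₀ := x) hu
    Metric.isOpen_ball (convex_ball _ _).isPreconnected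
    (g := fun n x => x ^ n • c n) (g' := fun (n : ℕ) x => ((n : ℂ) * x ^ (n - 1)) • c n)
    (fun n y _ => (hasDerivAt_pow n y).smul_const (c n)) (fun n y hy => ?_) (by simpa using hxρ)
    ?_ (by simpa using hxρ)
  · have hy' : ‖y‖ ≤ ρ := le_of_lt (by simpa using hy)
    rw [norm_smul, norm_mul, norm_pow, Complex.norm_natCast]
    gcongr
  · refine Summable.of_norm_bounded (hc ρ hρ hρr) fun n => ?_
    rw [norm_smul, norm_pow, mul_comm]
    gcongr

/-- Frobenius' theorem: the singular system `x F' = A(x) F - F b`, with `A(0)` and `b` nilpotent,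
has a power series solution with any admissible constant term, on the whole disc on which `A` is
given by a power series. -/
theorem exists_frobenius_solution {a : ℕ → 𝔸} {b c₀ : 𝔸} (ha : IsNilpotent (a 0))
    (hb : IsNilpotent b) (h₀ : a 0 * c₀ = c₀ * b) {r : ℝ} {A : ℂ → 𝔸}
    (hA : ∀ x ∈ Metric.ball (0 : ℂ) r, HasSum (fun k => x ^ k • a k) (A x)) :
    ∃ (c : ℕ → 𝔸) (F : ℂ → 𝔸), c 0 = c₀ ∧
      (∀ n : ℕ, (n : ℂ) • c n = ∑ k ∈ Finset.range (n + 1), a k * c (n - k) - c n * b) ∧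
      (∀ x ∈ Metric.ball (0 : ℂ) r, HasSum (fun k => x ^ k • c k) (F x)) ∧
      DifferentiableOn ℂ F (Metric.ball 0 r) ∧
      ∀ x ∈ Metric.ball (0 : ℂ) r, x • deriv F x = A x * F x - F x * b := by
  obtain ⟨c, hc0, hc⟩ := exists_frobenius_coeff a ha hb h₀
  have hsum : ∀ ρ : ℝ, 0 < ρ → ρ < r → Summable fun n => ‖c n‖ * ρ ^ n := fun ρ h1 h2 =>
    summable_norm_frobenius_coeff hc hA h1 h2
  have hderiv := fun x hx => hasDerivAt_powerSeries hsum (x := x) hx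
  have hnorm : ∀ {d : ℕ → 𝔸} {ρ : ℝ} {x : ℂ}, (Summable fun n => ‖d n‖ * ρ ^ n) → ‖x‖ ≤ ρ →
      Summable fun n => ‖x ^ n • d n‖ := by
    intro d ρ x hd hx
    refine Summable.of_nonneg_of_le (fun n => norm_nonneg _) (fun n => ?_) hd
    rw [norm_smul, norm_pow, mul_comm]
    gcongr
  refine ⟨c, fun x => ∑' n, x ^ n • c n, hc0, hc, fun x hx => ?_, fun x hx =>
    (hderiv x hx).differentiableAt.differentiableWithinAt, fun x hx => ?_⟩
  · have hxr : ‖x‖ < r := by simpa using hx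
    obtain ⟨ρ, hxρ, hρr⟩ := exists_between hxr
    exact (hnorm (hsum ρ ((norm_nonneg x).trans_lt hxρ) hρr) hxρ.le).of_norm.hasSum
  · have hxr : ‖x‖ < r := by simpa using hx
    obtain ⟨ρ, hxρ, hρr⟩ := exists_between hxr
    obtain ⟨s, hρs, hsr⟩ := exists_between hρr
    have hρ : 0 < ρ := (norm_nonneg x).trans_lt hxρ
    have hs : 0 < s := hρ.trans hρs
    have hcx : Summable fun n => ‖x ^ n • c n‖ := hnorm (hsum ρ hρ hρr) hxρ.le
    have hax : Summable fun n => ‖x ^ n • a n‖ := by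
      obtain ⟨K, hK0, hK⟩ := exists_norm_mul_pow_le hs.le
        (hA s (by simpa [abs_of_pos hs] using hsr))
      have hgeo : Summable fun n : ℕ => K * (ρ / s) ^ n :=
        (summable_geometric_of_lt_one (by positivity) ((div_lt_one hs).2 hρs)).mul_left _
      refine Summable.of_nonneg_of_le (fun n => norm_nonneg _) (fun n => ?_) hgeo
      rw [norm_smul, norm_pow]
      calc ‖x‖ ^ n * ‖a n‖ ≤ ρ ^ n * ‖a n‖ := by gcongr
        _ = (‖a n‖ * s ^ n) * (ρ / s) ^ n := by rw [div_pow]; field_simp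
        _ ≤ _ := by gcongr; exact hK n
    rw [(hderiv x hx).deriv, ← (hA x hx).tsum_eq,
      tsum_mul_tsum_eq_tsum_sum_range_of_summable_norm hax hcx, ← tsum_const_smul'']
    have hcb : Summable fun n => x ^ n • c n * b := hcx.of_norm.mul_right b
    have hprod := (summable_norm_sum_mul_range_of_summable_norm hax hcx).of_norm
    change _ = _ - (∑' n, x ^ n • c n) * b
    rw [← hcx.of_norm.tsum_mul_right, ← hprod.tsum_sub hcb]
    refine tsum_congr fun n => ?_
    have h1 : x • ((n : ℂ) * x ^ (n - 1)) • c n = x ^ n • ((n : ℂ) • c n) := by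
      rcases n with _ | n
      · simp
      · rw [smul_smul, smul_smul]
        congr 1
        simp only [Nat.add_sub_cancel, pow_succ]
        ring
    rw [h1, hc n, smul_sub, Finset.smul_sum, smul_mul_assoc]
    congr 1
    refine Finset.sum_congr rfl fun k hk => ?_
    have hk' := Finset.mem_range.1 hk
    rw [smul_mul_smul_comm, ← pow_add]
    congr 2
    omega

end Frobenius

/-- A holomorphic solution of `x Φ' = T Φ` on a disc is constant if `T` is nilpotent. -/
lemma eq_of_smul_deriv_eq_nilpotent {E : Type*} [NormedAddCommGroup E] [NormedSpace ℂ E]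
    [CompleteSpace E] {T : E →L[ℂ] E} (hT : IsNilpotent T) {r : ℝ} {Φ : ℂ → E}
    (hΦ : DifferentiableOn ℂ Φ (Metric.ball 0 r))
    (h : ∀ x ∈ Metric.ball (0 : ℂ) r, x • deriv Φ x = T (Φ x)) {x : ℂ}
    (hx : x ∈ Metric.ball (0 : ℂ) r) : Φ x = Φ 0 := by
  have hr : 0 < r := (norm_nonneg x).trans_lt (by simpa using hx)
  have h0 : (0 : ℂ) ∈ Metric.ball (0 : ℂ) r := by simpa using hr
  have hdiff : ∀ y ∈ Metric.ball (0 : ℂ) r, DifferentiableAt ℂ Φ y := fun y hy =>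
    hΦ.differentiableAt (Metric.isOpen_ball.mem_nhds hy)
  have hderivT : ∀ j : ℕ, ∀ y ∈ Metric.ball (0 : ℂ) r,
      HasDerivAt (fun y => (T ^ j) (Φ y)) ((T ^ j) (deriv Φ y)) y := fun j y hy =>
    (T ^ j).hasFDerivAt.comp_hasDerivAt y (hdiff y hy).hasDerivAt
  have hTj : ∀ j : ℕ, ∀ y ∈ Metric.ball (0 : ℂ) r,
      y • (T ^ j) (deriv Φ y) = (T ^ (j + 1)) (Φ y) := fun j y hy => by
    rw [← map_smul, h y hy, pow_succ]; rfl
  have hconst : ∀ j : ℕ, (∀ y ∈ Metric.ball (0 : ℂ) r, (T ^ (j + 1)) (Φ y) = 0) →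
      ∀ y ∈ Metric.ball (0 : ℂ) r, (T ^ j) (Φ y) = (T ^ j) (Φ 0) := by
    intro j hj
    -- Since y T^j Φ'(y) = T^(j+1) Φ(y) = 0, the derivative of T^j Φ vanishes off the origin, and
    -- then at the origin by continuity.
    have hd : ∀ y ∈ Metric.ball (0 : ℂ) r, y ≠ 0 → (T ^ j) (deriv Φ y) = 0 := fun y hy hy0 => by
      have := hTj j y hy
      rw [hj y hy] at this
      exact (smul_eq_zero.1 this).resolve_left hy0
    have hd0 : (T ^ j) (deriv Φ 0) = 0 := by
      have hc : ContinuousAt (fun y => (T ^ j) (deriv Φ y)) 0 :=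
        (T ^ j).continuous.continuousAt.comp
          ((hΦ.deriv Metric.isOpen_ball).continuousOn.continuousAt
            (Metric.isOpen_ball.mem_nhds h0))
      refine tendsto_nhds_unique (hc.tendsto.mono_left (nhdsWithin_le_nhds (s := {0}ᶜ)))
        (tendsto_const_nhds.congr' ?_)
      filter_upwards [self_mem_nhdsWithin, nhdsWithin_le_nhds (Metric.isOpen_ball.mem_nhds h0)]
        with y hy hy'
      exact (hd y hy' hy).symm
    intro y hy
    refine Metric.isOpen_ball.is_const_of_deriv_eq_zero (convex_ball (0 : ℂ) r).isPreconnected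
      (fun y hy => (hderivT j y hy).differentiableAt.differentiableWithinAt) (fun y hy => ?_) hy h0
    rw [(hderivT j y hy).deriv]
    rcases eq_or_ne y 0 with rfl | hy0
    · exact hd0
    · exact hd y hy hy0
  obtain ⟨m, hm⟩ := hT
  -- Downward induction on the power of T: once T^(j+2) Φ vanishes, T^(j+1) Φ is constant, and its
  -- value at the origin is 0 • T^j Φ'(0).
  have hzero : ∀ d j : ℕ, m ≤ j + 1 + d →
      ∀ y ∈ Metric.ball (0 : ℂ) r, (T ^ (j + 1)) (Φ y) = 0 := by
    intro d
    induction d with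
    | zero =>
      intro j hj y _
      rw [pow_eq_zero_of_le (by omega : m ≤ j + 1) hm]
      rfl
    | succ d ih =>
      intro j hj y hy
      rw [hconst (j + 1) (ih (j + 1) (by omega)) y hy, ← hTj j 0 h0, zero_smul]
  simpa using hconst 0 (hzero m 0 (by omega)) x hx

/-! ### The companion system and its invariant alternating form -/

section MatrixSystems

attribute [local instance] Matrix.linftyOpNormedRing Matrix.linftyOpNormedAlgebra

/-- Complex `4 × 4` matrices. -/
abbrev Mat := Matrix (Fin 4) (Fin 4) ℂ

/-- The linear functional that reads off an entry. -/
def entryCLM (i j : Fin 4) : Mat →L[ℂ] ℂ :=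
  LinearMap.toContinuousLinearMap (Matrix.entryLinearMap ℂ ℂ i j)

@[simp] lemma entryCLM_apply (i j : Fin 4) (M : Mat) : entryCLM i j M = M i j := rfl

/-- Transposition as a continuous linear map. -/
def transposeCLM : Mat →L[ℂ] Mat :=
  LinearMap.toContinuousLinearMap (Matrix.transposeLinearEquiv (Fin 4) (Fin 4) ℂ ℂ).toLinearMap

lemma hasDerivAt_matrix {U : ℂ → Mat} {U' : Mat} {z : ℂ} :
    HasDerivAt U U' z ↔ ∀ i j, HasDerivAt (fun z => U z i j) (U' i j) z := by
  refine ⟨fun h i j => (entryCLM i j).hasFDerivAt.comp_hasDerivAt z h, fun h => ?_⟩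
  have h1 : HasDerivAt (fun z => ∑ i, ∑ j, U z i j • (Matrix.single i j (1 : ℂ) : Mat))
      (∑ i, ∑ j, U' i j • (Matrix.single i j (1 : ℂ) : Mat)) z :=
    HasDerivAt.fun_sum fun i _ => HasDerivAt.fun_sum fun j _ => (h i j).smul_const _
  have h2 : ∀ M : Mat, ∑ i, ∑ j, M i j • (Matrix.single i j (1 : ℂ) : Mat) = M := fun M => by
    conv_rhs => rw [Matrix.matrix_eq_sum_single M]
    simp
  simpa only [h2] using h1

lemma hasDerivAt_transpose_mul_mul {U Q V : ℂ → Mat} {U' Q' V' : Mat} {z : ℂ}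
    (hU : HasDerivAt U U' z) (hQ : HasDerivAt Q Q' z) (hV : HasDerivAt V V' z) :
    HasDerivAt (fun z => (U z).transpose * Q z * V z)
      (U'.transpose * Q z * V z + (U z).transpose * Q' * V z +
        (U z).transpose * Q z * V') z := by
  have h1 : HasDerivAt (fun z => (U z).transpose) U'.transpose z :=
    transposeCLM.hasFDerivAt.comp_hasDerivAt z hU
  exact ((h1.mul hQ).mul hV).congr_deriv (by simp [add_mul])

/-- An invariant bilinear form of a singular system is constant, and equal to its value at the
singular point. -/
lemma frobenius_pairing_eq {F A Q Q' : ℂ → Mat} {b : Mat} (hb : IsNilpotent b) {r : ℝ}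
    (hF : DifferentiableOn ℂ F (Metric.ball 0 r))
    (hFA : ∀ x ∈ Metric.ball (0 : ℂ) r, x • deriv F x = A x * F x - F x * b)
    (hQ : ∀ x ∈ Metric.ball (0 : ℂ) r, HasDerivAt Q (Q' x) x)
    (hAQ : ∀ x ∈ Metric.ball (0 : ℂ) r,
      (A x).transpose * Q x + x • Q' x + Q x * A x = 0) {x : ℂ}
    (hx : x ∈ Metric.ball (0 : ℂ) r) :
    (F x).transpose * Q x * F x = (F 0).transpose * Q 0 * F 0 := by
  -- Φ = Fᵀ Q F satisfies x Φ' = -bᵀ Φ - Φ b, because the terms with A cancel by `hAQ`. The operator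
  -- on the right is nilpotent, so a Φ that is holomorphic at the singular point must be constant.
  set T : Module.End ℂ Mat := LinearMap.mulLeft ℂ (-b.transpose) - LinearMap.mulRight ℂ b with hT
  have hbt : IsNilpotent (-b.transpose) := by
    obtain ⟨n, hn⟩ := hb
    exact IsNilpotent.neg ⟨n, by rw [← Matrix.transpose_pow, hn, Matrix.transpose_zero]⟩
  have hTn : IsNilpotent T :=
    Commute.isNilpotent_sub (LinearMap.commute_mulLeft_right _ _)
      ((LinearMap.isNilpotent_mulLeft_iff ℂ _).2 hbt)
      ((LinearMap.isNilpotent_mulRight_iff ℂ b).2 hb)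
  have hTn' : IsNilpotent (Module.End.toContinuousLinearMap Mat T) := hTn.map _
  have hder : ∀ y ∈ Metric.ball (0 : ℂ) r, HasDerivAt (fun y => (F y).transpose * Q y * F y)
      ((deriv F y).transpose * Q y * F y + (F y).transpose * Q' y * F y +
        (F y).transpose * Q y * deriv F y) y := fun y hy =>
    hasDerivAt_transpose_mul_mul
      (hF.differentiableAt (Metric.isOpen_ball.mem_nhds hy)).hasDerivAt (hQ y hy)
      (hF.differentiableAt (Metric.isOpen_ball.mem_nhds hy)).hasDerivAt
  refine eq_of_smul_deriv_eq_nilpotent (Φ := fun y => (F y).transpose * Q y * F y) hTn'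
    (fun y hy => (hder y hy).differentiableAt.differentiableWithinAt) (fun y hy => ?_) hx
  rw [(hder y hy).deriv]
  have e1 : y • ((deriv F y).transpose * Q y * F y + (F y).transpose * Q' y * F y +
        (F y).transpose * Q y * deriv F y) =
      (y • deriv F y).transpose * Q y * F y + (F y).transpose * (y • Q' y) * F y +
        (F y).transpose * Q y * (y • deriv F y) := by
    simp [smul_add, Matrix.transpose_smul]
  have e2 : (Module.End.toContinuousLinearMap Mat T) ((F y).transpose * Q y * F y) =
      -b.transpose * ((F y).transpose * Q y * F y) - ((F y).transpose * Q y * F y) * b := by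
    change T _ = _
    simp [hT]
  rw [e1, e2, hFA y hy]
  have e3 : ((A y * F y - F y * b).transpose * Q y * F y + (F y).transpose * (y • Q' y) * F y +
        (F y).transpose * Q y * (A y * F y - F y * b)) =
      (F y).transpose * ((A y).transpose * Q y + y • Q' y + Q y * A y) * F y +
      (-b.transpose * ((F y).transpose * Q y * F y) - ((F y).transpose * Q y * F y) * b) := by
    rw [Matrix.transpose_sub, Matrix.transpose_mul, Matrix.transpose_mul]
    noncomm_ring
  rw [e3, hAQ y hy]
  simp

/-- The companion matrix of the hypergeometric equation in terms of `θ`, in the variable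
`t = z / μ`, for exponents with elementary symmetric functions `2, e₂, e₂ - 1, e₄`. -/
def companion (e₂ e₄ t : ℂ) : Mat :=
  !![0, 1, 0, 0;
     0, 0, 1, 0;
     0, 0, 0, 1;
     t / (1 - t) * e₄, t / (1 - t) * (e₂ - 1), t / (1 - t) * e₂, t / (1 - t) * 2]

/-- The invariant alternating form of the hypergeometric equation on jets. -/
def pairing (e₂ t : ℂ) : Mat :=
  !![0, (1 - e₂) * t, -t, 1 - t;
     -((1 - e₂) * t), 0, -(1 - t), 0;
     t, 1 - t, 0, 0;
     -(1 - t), 0, 0, 0]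

/-- The derivative of `pairing`. -/
def pairingDeriv (e₂ : ℂ) : Mat :=
  !![0, 1 - e₂, -1, -1;
     -(1 - e₂), 0, 1, 0;
     1, -1, 0, 0;
     1, 0, 0, 0]

lemma pairing_eq (e₂ t : ℂ) : pairing e₂ t = pairing e₂ 0 + t • pairingDeriv e₂ := by
  ext i j
  fin_cases i <;> fin_cases j <;> simp [pairing, pairingDeriv] <;> ring

lemma hasDerivAt_pairing (e₂ t : ℂ) : HasDerivAt (pairing e₂) (pairingDeriv e₂) t := by
  have h : HasDerivAt (fun t : ℂ => pairing e₂ 0 + t • pairingDeriv e₂) (pairingDeriv e₂) t := by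
    have h1 := ((hasDerivAt_id t).smul_const (pairingDeriv e₂)).const_add (pairing e₂ 0)
    rwa [one_smul] at h1
  exact h.congr_of_eventuallyEq (Eventually.of_forall (pairing_eq e₂))

/-- This is Aᵀ Q + t Q' + Q A = 0, the infinitesimal form of the constancy of uᵀ Q v for solutions
of θu = A u. It rests on e₁ = 2 and e₃ = e₂ - 1, which are built into the last row of `companion`.
-/
lemma companion_pairing (e₂ e₄ : ℂ) {t : ℂ} (ht : 1 - t ≠ 0) :
    (companion e₂ e₄ t).transpose * pairing e₂ t + t • pairingDeriv e₂ +
      pairing e₂ t * companion e₂ e₄ t = 0 := by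
  ext i j
  fin_cases i <;> fin_cases j <;>
    simp [pairing, pairingDeriv, companion, Matrix.mul_apply, Fin.sum_univ_four] <;>
    field_simp <;> ring

lemma isUnit_pairing (e₂ : ℂ) {t : ℂ} (ht : 1 - t ≠ 0) : IsUnit (pairing e₂ t) := by
  rw [Matrix.isUnit_iff_isUnit_det, isUnit_iff_ne_zero]
  have : (pairing e₂ t).det = (1 - t) ^ 4 := by
    simp [pairing, Matrix.det_succ_row_zero, Fin.sum_univ_succ, Fin.succAbove]
    ring
  rw [this]
  exact pow_ne_zero 4 ht

end MatrixSystems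

/-! ### The operators θ + c on germs -/

section Theta

lemma thetaAdd_congr {y y' : ℂ → ℂ} {p : ℂ} (c : ℂ) (h : y =ᶠ[𝓝 p] y') :
    thetaAdd c y =ᶠ[𝓝 p] thetaAdd c y' := by
  filter_upwards [h, h.deriv] with z h1 h2
  simp [thetaAdd, h1, h2]

lemma thetaAdd_eventuallyEq {u v : ℂ → ℂ} {p : ℂ} (hp : p ≠ 0) (c : ℂ)
    (h : ∀ᶠ z in 𝓝 p, HasDerivAt u (z⁻¹ * v z) z) :
    thetaAdd c u =ᶠ[𝓝 p] fun z => v z + c * u z := by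
  filter_upwards [h, isOpen_ne.mem_nhds hp] with z h1 h2
  have h2 : z ≠ 0 := h2
  simp only [thetaAdd, h1.deriv]
  field_simp

lemma AnalyticAt.thetaAdd {y : ℂ → ℂ} {p : ℂ} (h : AnalyticAt ℂ y p) (c : ℂ) :
    AnalyticAt ℂ (thetaAdd c y) p :=
  (analyticAt_id.mul h.deriv).add (analyticAt_const.mul h)

lemma AnalyticAt.hasDerivAt_thetaAdd {y : ℂ → ℂ} {p : ℂ} (hp : p ≠ 0) (h : AnalyticAt ℂ y p) :
    ∀ᶠ z in 𝓝 p, HasDerivAt y (z⁻¹ * HypergeometricCY.thetaAdd 0 y z) z := by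
  filter_upwards [h.eventually_analyticAt, isOpen_ne.mem_nhds hp] with z h1 h2
  have h2 : z ≠ 0 := h2
  refine h1.differentiableAt.hasDerivAt.congr_deriv ?_
  simp only [HypergeometricCY.thetaAdd]
  field_simp
  ring

lemma AnalyticAt.iterate_thetaAdd {y : ℂ → ℂ} {p : ℂ} (h : AnalyticAt ℂ y p) (n : ℕ) :
    AnalyticAt ℂ ((HypergeometricCY.thetaAdd 0)^[n] y) p := by
  induction n with
  | zero => simpa using h
  | succ n ih => rw [Function.iterate_succ_apply']; exact AnalyticAt.thetaAdd ih 0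

end Theta

/-! ### Self-duality and the expanded operator -/

/-- The second elementary symmetric function of the exponents. -/
def Data.e₂ (X : Data) : ℂ :=
  X.a 0 * X.a 1 + X.a 0 * X.a 2 + X.a 0 * X.a 3 + X.a 1 * X.a 2 + X.a 1 * X.a 3 + X.a 2 * X.a 3

/-- The product of the exponents. -/
def Data.e₄ (X : Data) : ℂ := X.a 0 * X.a 1 * X.a 2 * X.a 3

/-- The properties of the data that the argument uses: `μ` and `κ` do not vanish, and the equation
is self-dual. -/
structure Data.IsSelfDual (X : Data) : Prop where
  mu_ne : X.mu ≠ 0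
  kappa_ne : X.kappa ≠ 0
  sum_eq : (X.a 0 + X.a 1 + X.a 2 + X.a 3 : ℂ) = 2
  sum_three : (X.a 0 * X.a 1 * X.a 2 + X.a 0 * X.a 1 * X.a 3 + X.a 0 * X.a 2 * X.a 3 +
    X.a 1 * X.a 2 * X.a 3 : ℂ) = X.e₂ - 1

/-- In each row the exponents form pairs a, 1 - a; this gives e₁ = 2 and e₃ = a(1 - a) + b(1 - b) =
e₂ - 1. The rest of the proof uses the table only through this lemma. -/
lemma isSelfDual_of_mem {X : Data} (hX : X ∈ table) : X.IsSelfDual := by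
  simp only [table, List.mem_cons, List.not_mem_nil, or_false] at hX
  rcases hX with rfl | rfl | rfl | rfl | rfl | rfl | rfl | rfl | rfl | rfl | rfl | rfl | rfl | rfl <;>
  constructor <;> (simp [Data.mu, Data.e₂]; try norm_num)

lemma Data.IsSelfDual.alpha_eq {X : Data} (h : X.IsSelfDual) :
    (X.alpha : ℂ) = 3 / 4 * (2 - X.e₂) := by
  rw [← h.sum_eq]
  have h0 : Finset.Ioi (0 : Fin 4) = {1, 2, 3} := rfl
  have h1 : Finset.Ioi (1 : Fin 4) = {2, 3} := rfl
  have h2 : Finset.Ioi (2 : Fin 4) = {3} := rfl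
  have h3 : Finset.Ioi (3 : Fin 4) = ∅ := rfl
  simp [Data.alpha, Data.e₂, Fin.sum_univ_four, h0, h1, h2, h3]
  ring

/-- The chain u₀, …, u₄ abstracts θ uᵢ = uᵢ₊₁, so that the same expansion serves both directions:
for the rows of a jet matrix, with u₄ given by the companion row, and for the iterates of θ on a
given solution. -/
lemma Data.IsSelfDual.L_eventuallyEq {X : Data} (h : X.IsSelfDual) {u₀ u₁ u₂ u₃ u₄ : ℂ → ℂ} {p : ℂ}
    (hp : p ≠ 0) (h0 : ∀ᶠ z in 𝓝 p, HasDerivAt u₀ (z⁻¹ * u₁ z) z)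
    (h1 : ∀ᶠ z in 𝓝 p, HasDerivAt u₁ (z⁻¹ * u₂ z) z)
    (h2 : ∀ᶠ z in 𝓝 p, HasDerivAt u₂ (z⁻¹ * u₃ z) z)
    (h3 : ∀ᶠ z in 𝓝 p, HasDerivAt u₃ (z⁻¹ * u₄ z) z) :
    X.L u₀ =ᶠ[𝓝 p] fun z => u₄ z - z / X.mu *
      (u₄ z + 2 * u₃ z + X.e₂ * u₂ z + (X.e₂ - 1) * u₁ z + X.e₄ * u₀ z) := by
  have lin : ∀ {u v u' v' : ℂ → ℂ} (c : ℂ), (∀ᶠ z in 𝓝 p, HasDerivAt u (z⁻¹ * u' z) z) →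
      (∀ᶠ z in 𝓝 p, HasDerivAt v (z⁻¹ * v' z) z) →
      ∀ᶠ z in 𝓝 p, HasDerivAt (fun z => u z + c * v z) (z⁻¹ * (u' z + c * v' z)) z := by
    intro u v u' v' c hu hv
    filter_upwards [hu, hv] with z hu hv
    exact (hu.add (hv.const_mul c)).congr_deriv (by ring)
  have t0 : ∀ {u v : ℂ → ℂ}, (∀ᶠ z in 𝓝 p, HasDerivAt u (z⁻¹ * v z) z) →
      thetaAdd 0 u =ᶠ[𝓝 p] v := fun hu => by
    simpa using thetaAdd_eventuallyEq hp 0 hu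
  have i1 := t0 h0
  have i2 := (thetaAdd_congr 0 i1).trans (t0 h1)
  have i3 := (thetaAdd_congr 0 i2).trans (t0 h2)
  have i4 := (thetaAdd_congr 0 i3).trans (t0 h3)
  have d1 := lin (X.a 3) h1 h0
  have d2 := lin (X.a 3) h2 h1
  have d3 := lin (X.a 3) h3 h2
  have j1 := thetaAdd_eventuallyEq hp (X.a 3) h0
  have j2 := (thetaAdd_congr (X.a 2) j1).trans (thetaAdd_eventuallyEq hp (X.a 2) d1)
  have f1 := lin (X.a 2) d2 d1
  have f2 := lin (X.a 2) d3 d2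
  have j3 := (thetaAdd_congr (X.a 1) j2).trans (thetaAdd_eventuallyEq hp (X.a 1) f1)
  have k1 := lin (X.a 1) f2 f1
  have j4 := (thetaAdd_congr (X.a 0) j3).trans (thetaAdd_eventuallyEq hp (X.a 0) k1)
  filter_upwards [i4, j4] with z h4 h4'
  have h5 : (thetaAdd 0)^[4] u₀ z = u₄ z := h4
  rw [Data.L, h5, h4', ← h.sum_three, ← h.sum_eq, Data.e₂, Data.e₄]
  ring

/-! ### Jets of solutions and their constant Gram matrices -/

section Jets

section CompanionRows

variable (e₂ e₄ t : ℂ) (M : Mat) (i : Fin 4)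

lemma companion_mul_zero : (companion e₂ e₄ t * M) 0 i = M 1 i := by
  rw [Matrix.mul_apply]; simp [companion, Fin.sum_univ_four]

lemma companion_mul_one : (companion e₂ e₄ t * M) 1 i = M 2 i := by
  rw [Matrix.mul_apply]; simp [companion, Fin.sum_univ_four]

lemma companion_mul_two : (companion e₂ e₄ t * M) 2 i = M 3 i := by
  rw [Matrix.mul_apply]; simp [companion, Fin.sum_univ_four]

lemma companion_mul_three : (companion e₂ e₄ t * M) 3 i =
    t / (1 - t) * (2 * M 3 i + e₂ * M 2 i + (e₂ - 1) * M 1 i + e₄ * M 0 i) := by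
  rw [Matrix.mul_apply]; simp [companion, Fin.sum_univ_four]; ring

end CompanionRows

attribute [local instance] Matrix.linftyOpNormedRing Matrix.linftyOpNormedAlgebra

/-- Near `p`, the columns of `U` are the jets `(y, θ y, θ² y, θ³ y)` of solutions. -/
def Data.IsJetAt (X : Data) (U : ℂ → Mat) (p : ℂ) : Prop :=
  ∀ᶠ z in 𝓝 p, HasDerivAt U (z⁻¹ • (companion X.e₂ X.e₄ (z / X.mu) * U z)) z

variable {X : Data} {U V : ℂ → Mat} {p : ℂ}

lemma Data.IsJetAt.mul_const (hU : X.IsJetAt U p) (C : Mat) :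
    X.IsJetAt (fun z => U z * C) p := by
  filter_upwards [hU] with z hz
  exact (hz.mul_const C).congr_deriv (by rw [smul_mul_assoc, mul_assoc])

lemma Data.IsJetAt.sub (hU : X.IsJetAt U p) (hV : X.IsJetAt V p) :
    X.IsJetAt (fun z => U z - V z) p := by
  filter_upwards [hU, hV] with z hz hz'
  exact (hz.sub hz').congr_deriv (by rw [mul_sub, smul_sub])

lemma Data.IsJetAt.hasDerivAt_entry (hU : X.IsJetAt U p) (i : Fin 4) :
    (∀ᶠ z in 𝓝 p, HasDerivAt (fun z => U z 0 i) (z⁻¹ * U z 1 i) z) ∧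
    (∀ᶠ z in 𝓝 p, HasDerivAt (fun z => U z 1 i) (z⁻¹ * U z 2 i) z) ∧
    (∀ᶠ z in 𝓝 p, HasDerivAt (fun z => U z 2 i) (z⁻¹ * U z 3 i) z) ∧
    ∀ᶠ z in 𝓝 p, HasDerivAt (fun z => U z 3 i) (z⁻¹ * (z / X.mu / (1 - z / X.mu) *
      (2 * U z 3 i + X.e₂ * U z 2 i + (X.e₂ - 1) * U z 1 i + X.e₄ * U z 0 i))) z := by
  refine ⟨?_, ?_, ?_, ?_⟩ <;> filter_upwards [hU] with z hz
  · exact (hasDerivAt_matrix.1 hz 0 i).congr_deriv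
      (by rw [Matrix.smul_apply, companion_mul_zero, smul_eq_mul])
  · exact (hasDerivAt_matrix.1 hz 1 i).congr_deriv
      (by rw [Matrix.smul_apply, companion_mul_one, smul_eq_mul])
  · exact (hasDerivAt_matrix.1 hz 2 i).congr_deriv
      (by rw [Matrix.smul_apply, companion_mul_two, smul_eq_mul])
  · exact (hasDerivAt_matrix.1 hz 3 i).congr_deriv
      (by rw [Matrix.smul_apply, companion_mul_three, smul_eq_mul])

lemma eventually_one_sub_ne (hp : X.delta p ≠ 0) : ∀ᶠ z in 𝓝 p, 1 - z / X.mu ≠ 0 := by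
  have : ContinuousAt X.delta p := by
    change ContinuousAt (fun z => 1 - z / X.mu) p
    fun_prop
  exact this.eventually_ne hp

lemma Data.IsJetAt.isSolutionAt (h : X.IsSelfDual) (hp : p ≠ 0) (hp' : X.delta p ≠ 0)
    (hU : X.IsJetAt U p) (i : Fin 4) : X.IsSolutionAt (fun z => U z 0 i) p := by
  obtain ⟨h0, h1, h2, h3⟩ := hU.hasDerivAt_entry i
  refine ⟨Complex.analyticAt_iff_eventually_differentiableAt.2
    (h0.mono fun z hz => hz.differentiableAt), ?_⟩
  filter_upwards [h.L_eventuallyEq hp h0 h1 h2 h3, eventually_one_sub_ne hp'] with z hz hz'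
  rw [hz]
  field_simp
  ring

lemma isJetAt_of_isSolutionAt (h : X.IsSelfDual) (hp : p ≠ 0) (hp' : X.delta p ≠ 0)
    {Y : ℂ → Fin 4 → ℂ} (hY : ∀ i, X.IsSolutionAt (fun z => Y z i) p) :
    X.IsJetAt (fun z => Matrix.of fun j i => (thetaAdd 0)^[j] (fun z => Y z i) z) p := by
  have han : ∀ (n : ℕ) (i : Fin 4), ∀ᶠ z in 𝓝 p,
      HasDerivAt ((thetaAdd 0)^[n] (fun z => Y z i))
        (z⁻¹ * (thetaAdd 0)^[n + 1] (fun z => Y z i) z) z := fun n i => by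
    rw [Function.iterate_succ_apply']
    exact AnalyticAt.hasDerivAt_thetaAdd hp (AnalyticAt.iterate_thetaAdd (hY i).1 n)
  have hL : ∀ i, ∀ᶠ z in 𝓝 p, (thetaAdd 0)^[4] (fun z => Y z i) z =
      z / X.mu / (1 - z / X.mu) * (2 * (thetaAdd 0)^[3] (fun z => Y z i) z +
        X.e₂ * (thetaAdd 0)^[2] (fun z => Y z i) z +
        (X.e₂ - 1) * (thetaAdd 0)^[1] (fun z => Y z i) z + X.e₄ * Y z i) := fun i => by
    filter_upwards [(hY i).2, h.L_eventuallyEq hp (han 0 i) (han 1 i) (han 2 i) (han 3 i),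
      eventually_one_sub_ne hp'] with z h1 h2 h3
    have h2 : _ = (thetaAdd 0)^[4] (fun z => Y z i) z - z / X.mu *
      ((thetaAdd 0)^[4] (fun z => Y z i) z + 2 * (thetaAdd 0)^[3] (fun z => Y z i) z +
        X.e₂ * (thetaAdd 0)^[2] (fun z => Y z i) z +
        (X.e₂ - 1) * (thetaAdd 0)^[1] (fun z => Y z i) z + X.e₄ * Y z i) := h1.symm.trans h2
    rw [div_mul_eq_mul_div, eq_div_iff h3]
    linear_combination -h2
  have han' : ∀ᶠ z in 𝓝 p, ∀ i, ∀ n : Fin 4,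
      HasDerivAt ((thetaAdd 0)^[n] (fun z => Y z i))
        (z⁻¹ * (thetaAdd 0)^[n + 1] (fun z => Y z i) z) z :=
    eventually_all.2 fun i => eventually_all.2 fun n => han n i
  filter_upwards [han', eventually_all.2 hL] with z h1 h2
  refine hasDerivAt_matrix.2 fun j i => ?_
  have h3 := h1 i j
  simp only [Matrix.of_apply]
  refine h3.congr_deriv ?_
  rw [Matrix.smul_apply, smul_eq_mul]
  congr 1
  fin_cases j
  · exact (companion_mul_zero X.e₂ X.e₄ (z / X.mu)
      (Matrix.of fun j i => (thetaAdd 0)^[j] (fun z => Y z i) z) i).symm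
  · exact (companion_mul_one X.e₂ X.e₄ (z / X.mu)
      (Matrix.of fun j i => (thetaAdd 0)^[j] (fun z => Y z i) z) i).symm
  · exact (companion_mul_two X.e₂ X.e₄ (z / X.mu)
      (Matrix.of fun j i => (thetaAdd 0)^[j] (fun z => Y z i) z) i).symm
  · exact (h2 i).trans (companion_mul_three X.e₂ X.e₄ (z / X.mu)
      (Matrix.of fun j i => (thetaAdd 0)^[j] (fun z => Y z i) z) i).symm

/-- In companion form each row is θ of the preceding one, so the vanishing of the first row as a
germ propagates downwards. -/
lemma Data.IsJetAt.eq_zero (hp : p ≠ 0) (hU : X.IsJetAt U p)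
    (h0 : ∀ i, ∀ᶠ z in 𝓝 p, U z 0 i = 0) : ∀ᶠ z in 𝓝 p, U z = 0 := by
  have step : ∀ {u v : ℂ → ℂ}, (∀ᶠ z in 𝓝 p, HasDerivAt u (z⁻¹ * v z) z) →
      (∀ᶠ z in 𝓝 p, u z = 0) → ∀ᶠ z in 𝓝 p, v z = 0 := by
    intro u v h1 h2
    filter_upwards [h1, h2.eventually_nhds, isOpen_ne.mem_nhds hp] with z h1 h2 h3
    have h4 : HasDerivAt u 0 z := (hasDerivAt_const z (0 : ℂ)).congr_of_eventuallyEq h2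
    exact (mul_eq_zero.1 (h1.unique h4)).resolve_left (inv_ne_zero h3)
  have key : ∀ i, ∀ᶠ z in 𝓝 p, U z 0 i = 0 ∧ U z 1 i = 0 ∧ U z 2 i = 0 ∧ U z 3 i = 0 := by
    intro i
    obtain ⟨d0, d1, d2, -⟩ := hU.hasDerivAt_entry i
    have h1 := step d0 (h0 i)
    have h2 := step d1 h1
    have h3 := step d2 h2
    filter_upwards [h0 i, h1, h2, h3] with z a b c d using ⟨a, b, c, d⟩
  filter_upwards [eventually_all.2 key] with z hz
  ext j i
  obtain ⟨a, b, c, d⟩ := hz i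
  fin_cases j <;> simpa

lemma Data.IsJetAt.eventuallyEq_of_row (hp : p ≠ 0) (hU : X.IsJetAt U p) (hV : X.IsJetAt V p)
    (h0 : ∀ i, ∀ᶠ z in 𝓝 p, U z 0 i = V z 0 i) : U =ᶠ[𝓝 p] V := by
  filter_upwards [(hU.sub hV).eq_zero hp fun i => (h0 i).mono fun z hz => by simp [hz]] with z hz
  exact sub_eq_zero.1 hz

/-- The invariant form of two systems of solutions. -/
def Data.jetPairing (X : Data) (U V : ℂ → Mat) (z : ℂ) : Mat :=
  (U z).transpose * pairing X.e₂ (z / X.mu) * V z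

lemma Data.IsJetAt.hasDerivAt_jetPairing (hU : X.IsJetAt U p) (hV : X.IsJetAt V p)
    (hp : p ≠ 0) (hp' : X.delta p ≠ 0) :
    ∀ᶠ z in 𝓝 p, HasDerivAt (X.jetPairing U V) 0 z := by
  filter_upwards [hU, hV, isOpen_ne.mem_nhds hp, eventually_one_sub_ne hp'] with z h1 h2 h3 h4
  have h3 : z ≠ 0 := h3
  have hQ : HasDerivAt (fun z => pairing X.e₂ (z / X.mu)) (X.mu⁻¹ • pairingDeriv X.e₂) z := by
    exact ((hasDerivAt_pairing X.e₂ (z / X.mu)).scomp z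
      ((hasDerivAt_id z).div_const X.mu)).congr_deriv (by rw [one_div])
  refine (hasDerivAt_transpose_mul_mul h1 hQ h2).congr_deriv ?_
  have key := companion_pairing X.e₂ X.e₄ h4
  set A := companion X.e₂ X.e₄ (z / X.mu)
  set Q := pairing X.e₂ (z / X.mu)
  have e : (z⁻¹ • (A * U z)).transpose * Q * V z +
      (U z).transpose * (X.mu⁻¹ • pairingDeriv X.e₂) * V z +
      (U z).transpose * Q * (z⁻¹ • (A * V z)) =
      z⁻¹ • ((U z).transpose * (A.transpose * Q + (z / X.mu) • pairingDeriv X.e₂ + Q * A) * V z) := by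
    have e1 : X.mu⁻¹ • pairingDeriv X.e₂ = z⁻¹ • ((z / X.mu) • pairingDeriv X.e₂) := by
      rw [smul_smul]
      congr 1
      field_simp
    rw [e1, Matrix.transpose_smul, Matrix.transpose_mul]
    simp only [Matrix.smul_mul, Matrix.mul_smul, mul_add, add_mul, smul_add, mul_assoc]
  rw [e, key]
  simp

lemma Data.IsJetAt.jetPairing_eventuallyEq (hU : X.IsJetAt U p) (hV : X.IsJetAt V p)
    (hp : p ≠ 0) (hp' : X.delta p ≠ 0) :
    ∀ᶠ z in 𝓝 p, X.jetPairing U V z = X.jetPairing U V p := by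
  obtain ⟨ε, hε, h⟩ := Metric.eventually_nhds_iff_ball.1 (hU.hasDerivAt_jetPairing hV hp hp')
  filter_upwards [Metric.ball_mem_nhds p hε] with z hz
  exact Metric.isOpen_ball.is_const_of_deriv_eq_zero (convex_ball p ε).isPreconnected
    (fun y hy => (h y hy).differentiableAt.differentiableWithinAt)
    (fun y hy => (h y hy).deriv) hz (Metric.mem_ball_self hε)

/-- With P = Uᵀ Q, both P U = K and P V = K' are constant near p. Since K is invertible, so is P,
and V = U K⁻¹ K'. No uniqueness theorem for differential equations is needed. -/
lemma Data.IsJetAt.exists_eq_mul (hU : X.IsJetAt U p) (hV : X.IsJetAt V p) (hp : p ≠ 0)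
    (hp' : X.delta p ≠ 0) (hunit : IsUnit (X.jetPairing U U p)) :
    ∃ C : Mat, ∀ᶠ z in 𝓝 p, V z = U z * C := by
  refine ⟨(X.jetPairing U U p)⁻¹ * X.jetPairing U V p, ?_⟩
  filter_upwards [hU.jetPairing_eventuallyEq hU hp hp', hU.jetPairing_eventuallyEq hV hp hp']
    with z h1 h2
  set K := X.jetPairing U U p
  set K' := X.jetPairing U V p
  set P := (U z).transpose * pairing X.e₂ (z / X.mu)
  have h1 : P * U z = K := h1
  have h2 : P * V z = K' := h2
  have hKdet := (Matrix.isUnit_iff_isUnit_det _).1 hunit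
  have hP : IsUnit P.det := by
    rw [← h1, Matrix.det_mul] at hKdet
    exact isUnit_of_mul_isUnit_left hKdet
  have h3 : P * V z = P * (U z * (K⁻¹ * K')) := by
    rw [← mul_assoc, h1, ← mul_assoc, Matrix.mul_nonsing_inv _ hKdet, one_mul, h2]
  calc V z = P⁻¹ * (P * V z) := by rw [← mul_assoc, Matrix.nonsing_inv_mul _ hP, one_mul]
    _ = _ := by rw [h3, ← mul_assoc, Matrix.nonsing_inv_mul _ hP, one_mul]

lemma isUnit_of_isUnit_jetPairing (hunit : IsUnit (X.jetPairing U V p)) : IsUnit (V p) := by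
  rw [Matrix.isUnit_iff_isUnit_det] at hunit ⊢
  rw [Data.jetPairing, Matrix.det_mul] at hunit
  exact isUnit_of_mul_isUnit_right hunit

lemma Data.IsJetAt.isSolutionBasisAt (h : X.IsSelfDual) (hU : X.IsJetAt U p) (hp : p ≠ 0)
    (hp' : X.delta p ≠ 0) (hunit : IsUnit (X.jetPairing U U p)) :
    X.IsSolutionBasisAt (fun z => U z 0) p := by
  refine ⟨fun i => hU.isSolutionAt h hp hp' i, fun y hy => ?_⟩
  -- The single solution is repeated in all four columns, so that the statement on square jet
  -- matrices applies; likewise for `D` below.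
  have hV := isJetAt_of_isSolutionAt h hp hp' (Y := fun z _ => y z) (fun _ => hy)
  obtain ⟨C, hC⟩ := hU.exists_eq_mul hV hp hp' hunit
  have hyC : y =ᶠ[𝓝 p] fun z => ∑ i, C i 0 * U z 0 i := by
    filter_upwards [hC] with z hz
    have := congrFun (congrFun hz 0) 0
    simp only [Matrix.of_apply, Fin.val_zero, Function.iterate_zero, id, Matrix.mul_apply] at this
    rw [this]
    exact Finset.sum_congr rfl fun i _ => mul_comm _ _
  refine ⟨fun i => C i 0, hyC, fun c hc => ?_⟩
  set D : Mat := Matrix.of fun i _ => c i - C i 0 with hD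
  have h0 := (hU.mul_const D).eq_zero hp fun i => by
    filter_upwards [hyC, hc] with z h1 h2
    have h3 : ∑ i, c i * U z 0 i = ∑ i, C i 0 * U z 0 i := h2.symm.trans h1
    simp only [Matrix.mul_apply, hD, Matrix.of_apply, mul_sub, Finset.sum_sub_distrib]
    rw [sub_eq_zero]
    simpa only [mul_comm] using h3
  have h1 : U p * D = 0 := h0.self_of_nhds
  have hD0 : D = 0 := (isUnit_of_isUnit_jetPairing hunit).mul_right_eq_zero.1 h1
  funext i
  exact sub_eq_zero.1 (congrFun (congrFun hD0 i) 0)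

end Jets

/-! ### Local fundamental systems and continuation along paths -/

section Continuation

attribute [local instance] Matrix.linftyOpNormedRing Matrix.linftyOpNormedAlgebra

lemma differentiableAt_companion (e₂ e₄ : ℂ) {t : ℂ} (ht : 1 - t ≠ 0) :
    DifferentiableAt ℂ (companion e₂ e₄) t := by
  have h1 : DifferentiableAt ℂ (fun t : ℂ => companion e₂ e₄ 0 + (t / (1 - t)) •
      !![0, 0, 0, 0; 0, 0, 0, 0; 0, 0, 0, 0; e₄, e₂ - 1, e₂, 2]) t := by
    have h2 : DifferentiableAt ℂ (fun t : ℂ => t / (1 - t)) t :=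
      differentiableAt_id.div (differentiableAt_id.const_sub 1) ht
    exact (h2.smul_const _).const_add _
  refine h1.congr_of_eventuallyEq (Eventually.of_forall fun t => ?_)
  ext i j
  fin_cases i <;> fin_cases j <;> simp [companion]

/-- A holomorphic function on a disc is the sum of a power series on a smaller disc. -/
lemma exists_hasSum_powerSeries {A : ℂ → Mat} {R : ℝ} (hR : 0 < R)
    (hA : DifferentiableOn ℂ A (Metric.closedBall 0 R)) :
    ∃ a : ℕ → Mat, ∀ x ∈ Metric.ball (0 : ℂ) R, HasSum (fun k => x ^ k • a k) (A x) := by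
  lift R to NNReal using hR.le
  have h := hA.hasFPowerSeriesOnBall (by exact_mod_cast hR)
  refine ⟨fun k => (cauchyPowerSeries A 0 R).coeff k, fun x hx => ?_⟩
  have hx' : x ∈ Metric.eball (0 : ℂ) R := by
    simpa [Metric.eball_coe] using hx
  have := h.hasSum hx'
  rw [zero_add] at this
  refine this.congr_fun ?_ 
  intro k
  simp

variable {X : Data}

/-- An ordinary point is the case of zero residue: F' = G F is written as x F' = (x G) F. The Gram
matrix is constant on the disc, and at p, where Ψ = 1, it is the value of the form itself, hence
invertible. -/
lemma exists_fundamental {p : ℂ} (hp : p ≠ 0) (hp' : X.delta p ≠ 0) :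
    ∃ r > 0, ∃ Ψ : ℂ → Mat, ∀ z ∈ Metric.ball p r,
      X.IsJetAt Ψ z ∧ IsUnit (X.jetPairing Ψ Ψ z) := by
  set G : ℂ → Mat := fun z => z⁻¹ • companion X.e₂ X.e₄ (z / X.mu) with hG
  have hopen : ∀ᶠ z in 𝓝 p, z ≠ 0 ∧ 1 - z / X.mu ≠ 0 :=
    Eventually.and (isOpen_ne.mem_nhds hp) (eventually_one_sub_ne hp')
  obtain ⟨R, hR, hball⟩ := Metric.nhds_basis_closedBall.eventually_iff.1 hopen
  have hGd : ∀ z ∈ Metric.closedBall p R, DifferentiableAt ℂ G z := fun z hz => by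
    obtain ⟨h1, h2⟩ := hball hz
    have h3 : DifferentiableAt ℂ (fun z => companion X.e₂ X.e₄ (z / X.mu)) z :=
      DifferentiableAt.comp (g := companion X.e₂ X.e₄) (f := fun z => z / X.mu) z
        (differentiableAt_companion X.e₂ X.e₄ h2) (differentiableAt_id.div_const X.mu)
    exact (differentiableAt_inv h1).smul h3
  have hmem : ∀ x ∈ Metric.closedBall (0 : ℂ) R, p + x ∈ Metric.closedBall p R := fun x hx => by
    simpa using hx
  have hGx : ∀ x ∈ Metric.closedBall (0 : ℂ) R, DifferentiableAt ℂ (fun x => G (p + x)) x :=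
    fun x hx => (hGd _ (hmem x hx)).comp x (differentiableAt_id.const_add p)
  obtain ⟨a, ha⟩ := exists_hasSum_powerSeries (A := fun x => x • G (p + x)) hR
    fun x hx => (differentiableAt_id.smul (hGx x hx)).differentiableWithinAt
  have h0 : (0 : ℂ) ∈ Metric.ball (0 : ℂ) R := by simpa using hR
  have hval : ∀ {c : ℕ → Mat} {y : Mat}, HasSum (fun k => (0 : ℂ) ^ k • c k) y → y = c 0 := by
    intro c y h
    have h1 := hasSum_single (f := fun k => (0 : ℂ) ^ k • c k) 0 fun k hk => by simp [hk]
    simpa using h.unique h1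
  have ha0 : a 0 = 0 := by simpa using (hval (ha 0 h0)).symm
  obtain ⟨c, F, hc0, -, hcF, hFd, hF⟩ := exists_frobenius_solution (a := a) (b := 0) (c₀ := 1)
    (by rw [ha0]; exact IsNilpotent.zero) IsNilpotent.zero (by simp [ha0]) ha
  have hF0 : F 0 = 1 := by rw [hval (hcF 0 h0), hc0]
  have hFat : ∀ x ∈ Metric.ball (0 : ℂ) R, DifferentiableAt ℂ F x := fun x hx =>
    hFd.differentiableAt (Metric.isOpen_ball.mem_nhds hx)
  have hne : ∀ x ∈ Metric.ball (0 : ℂ) R, x ≠ 0 → deriv F x = G (p + x) * F x := by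
    intro x hx hx0
    have h1 := hF x hx
    rw [mul_zero, sub_zero, smul_mul_assoc] at h1
    exact smul_right_injective _ hx0 h1
  have hderiv : ∀ x ∈ Metric.ball (0 : ℂ) R, deriv F x = G (p + x) * F x := by
    intro x hx
    rcases eq_or_ne x 0 with rfl | hx0
    · have c1 : ContinuousAt (deriv F) 0 :=
        (hFd.deriv Metric.isOpen_ball).continuousOn.continuousAt (Metric.isOpen_ball.mem_nhds h0)
      have c2 : ContinuousAt (fun x => G (p + x) * F x) 0 :=
        (hGx 0 (Metric.ball_subset_closedBall h0)).continuousAt.mul (hFat 0 h0).continuousAt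
      refine tendsto_nhds_unique (c1.tendsto.mono_left (nhdsWithin_le_nhds (s := {0}ᶜ)))
        ((c2.tendsto.mono_left nhdsWithin_le_nhds).congr' ?_)
      filter_upwards [self_mem_nhdsWithin, nhdsWithin_le_nhds (Metric.isOpen_ball.mem_nhds h0)]
        with y hy hy'
      exact (hne y hy' hy).symm
    · exact hne x hx hx0
  set Ψ : ℂ → Mat := fun z => F (z - p) with hΨ
  have hmem' : ∀ z ∈ Metric.ball p R, z - p ∈ Metric.ball (0 : ℂ) R := fun z hz => by
    simpa [dist_eq_norm] using hz
  have hΨd : ∀ z ∈ Metric.ball p R,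
      HasDerivAt Ψ (z⁻¹ • (companion X.e₂ X.e₄ (z / X.mu) * Ψ z)) z := fun z hz => by
    have h1 := (hFat _ (hmem' z hz)).hasDerivAt.scomp z ((hasDerivAt_id z).sub_const p)
    refine h1.congr_deriv ((one_smul ℂ _).trans ((hderiv _ (hmem' z hz)).trans ?_))
    rw [add_sub_cancel, hG, smul_mul_assoc]
  have hjet : ∀ z ∈ Metric.ball p R, X.IsJetAt Ψ z := fun z hz => by
    filter_upwards [Metric.isOpen_ball.mem_nhds hz] with y hy using hΨd y hy
  refine ⟨R, hR, Ψ, fun z hz => ⟨hjet z hz, ?_⟩⟩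
  have hpR : p ∈ Metric.ball p R := Metric.mem_ball_self hR
  have hpair : ∀ z ∈ Metric.ball p R, HasDerivAt (X.jetPairing Ψ Ψ) 0 z := fun z hz => by
    obtain ⟨h1, h2⟩ := hball (Metric.ball_subset_closedBall hz)
    exact ((hjet z hz).hasDerivAt_jetPairing (hjet z hz) h1 h2).self_of_nhds
  have heq : X.jetPairing Ψ Ψ z = X.jetPairing Ψ Ψ p :=
    Metric.isOpen_ball.is_const_of_deriv_eq_zero (convex_ball p R).isPreconnected
      (fun y hy => (hpair y hy).differentiableAt.differentiableWithinAt)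
      (fun y hy => (hpair y hy).deriv) hz hpR
  rw [heq, Data.jetPairing]
  simp only [hΨ, sub_self, hF0, Matrix.transpose_one, one_mul, mul_one]
  exact isUnit_pairing _ hp'

/-- Systems of solutions can be continued along every path that avoids the singular points. -/
lemma exists_jet_continuation {p q : ℂ} (γ : Path p q)
    (hγ : ∀ t, γ t ≠ 0 ∧ X.delta (γ t) ≠ 0) {U : ℂ → Mat} (hU : X.IsJetAt U p) :
    ∃ F : unitInterval → ℂ → Mat, F 0 = U ∧ (∀ t, X.IsJetAt (F t) (γ t)) ∧
      ∀ t, ∀ᶠ s in 𝓝 t, F s =ᶠ[𝓝 (γ s)] F t := by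
  choose r hr Ψ hΨ using fun t => exists_fundamental (hγ t).1 (hγ t).2
  obtain ⟨τ, hτ0, hτmono, ⟨N, hN⟩, hτ⟩ := exists_monotone_Icc_subset_open_cover_unitInterval
    (c := fun t => γ ⁻¹' Metric.ball (γ t) (r t))
    (fun t => Metric.isOpen_ball.preimage γ.continuous)
    (fun t _ => Set.mem_iUnion.2 ⟨t, Metric.mem_ball_self (hr t)⟩)
  -- Induction along a subdivision each of whose pieces stays in one disc with a fundamental system
  -- Ψ. At the start of a piece the germ reached so far is Ψ C, and Ψ C is then kept on the whole
  -- piece. Compatibility is required only within parameters up to τ n, since nothing is prescribed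
  -- beyond.
  have key : ∀ n, ∃ F : unitInterval → ℂ → Mat, F 0 = U ∧
      (∀ t ≤ τ n, X.IsJetAt (F t) (γ t)) ∧
      ∀ t ≤ τ n, ∀ᶠ s in 𝓝[Set.Iic (τ n)] t, F s =ᶠ[𝓝 (γ s)] F t := by
    intro n
    induction n with
    | zero =>
      refine ⟨fun _ => U, rfl, fun t ht => ?_, fun t _ => Eventually.of_forall fun s =>
        EventuallyEq.rfl⟩
      have : t = 0 := le_antisymm (hτ0 ▸ ht) unitInterval.nonneg'
      rw [this, γ.source]
      exact hU
    | succ n ih =>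
      obtain ⟨F, hF0, hFjet, hFc⟩ := ih
      obtain ⟨i, hi⟩ := hτ n
      have hmono := hτmono (Nat.le_succ n)
      have hstart : γ (τ n) ∈ Metric.ball (γ i) (r i) := hi ⟨le_rfl, hmono⟩
      obtain ⟨C, hC⟩ := (hΨ i _ hstart).1.exists_eq_mul (hFjet _ le_rfl) (hγ _).1 (hγ _).2
        (hΨ i _ hstart).2
      set V : ℂ → Mat := fun z => Ψ i z * C with hV
      have hVU : F (τ n) =ᶠ[𝓝 (γ (τ n))] V := hC
      set F' : unitInterval → ℂ → Mat := fun s => if s ≤ τ n then F s else V with hF'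
      have hle : ∀ {s}, s ≤ τ n → F' s = F s := fun h => if_pos h
      have hgt : ∀ {s}, τ n < s → F' s = V := fun h => if_neg (not_le.2 h)
      refine ⟨F', ?_, fun t ht => ?_, fun t ht => ?_⟩
      · rw [hle unitInterval.nonneg', hF0]
      · rcases le_or_gt t (τ n) with h | h
        · rw [hle h]; exact hFjet t h
        · rw [hgt h]
          exact (hΨ i _ (hi ⟨h.le, ht⟩)).1.mul_const C
      · rcases lt_trichotomy t (τ n) with h | h | h
        · have h1 := hFc t h.le
          rw [nhdsWithin_eq_nhds.2 (Iic_mem_nhds h)] at h1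
          refine nhdsWithin_le_nhds ?_
          filter_upwards [h1, Iio_mem_nhds h] with s hs hs'
          rw [hle (le_of_lt hs'), hle h.le]
          exact hs
        · subst h
          rw [hle le_rfl]
          have h1 := eventually_nhdsWithin_iff.1 (hFc (τ n) le_rfl)
          have h2 : ∀ᶠ s in 𝓝 (τ n), F (τ n) =ᶠ[𝓝 (γ s)] V :=
            γ.continuous.continuousAt.eventually hVU.eventually_nhds
          refine nhdsWithin_le_nhds ?_
          filter_upwards [h1, h2] with s hs hs'
          rcases le_or_gt s (τ n) with h | h
          · rw [hle h]; exact hs h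
          · rw [hgt h]; exact hs'.symm
        · refine nhdsWithin_le_nhds ?_
          filter_upwards [Ioi_mem_nhds h] with s hs
          rw [hgt hs, hgt h]
  obtain ⟨F, hF0, hFjet, hFc⟩ := key N
  rw [hN N le_rfl] at hFjet hFc
  refine ⟨F, hF0, fun t => hFjet t unitInterval.le_one', fun t => ?_⟩
  have h := hFc t unitInterval.le_one'
  have hI : Set.Iic (1 : unitInterval) = Set.univ :=
    Set.eq_univ_of_forall fun s => unitInterval.le_one'
  rwa [hI, nhdsWithin_univ] at h

/-- The invariant form is preserved by analytic continuation. -/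
lemma jetPairing_continuation {p q : ℂ} (γ : Path p q)
    (hγ : ∀ t, γ t ≠ 0 ∧ X.delta (γ t) ≠ 0) {F : unitInterval → ℂ → Mat}
    (hF : ∀ t, X.IsJetAt (F t) (γ t)) (hFc : ∀ t, ∀ᶠ s in 𝓝 t, F s =ᶠ[𝓝 (γ s)] F t) :
    X.jetPairing (F 1) (F 1) q = X.jetPairing (F 0) (F 0) p := by
  have hloc : IsLocallyConstant fun t => X.jetPairing (F t) (F t) (γ t) := by
    refine IsLocallyConstant.iff_eventually_eq _ |>.2 fun t => ?_
    filter_upwards [hFc t, γ.continuous.continuousAt.eventually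
      ((hF t).jetPairing_eventuallyEq (hF t) (hγ t).1 (hγ t).2)] with s h1 h2
    rw [← h2]
    simp only [Data.jetPairing, h1.self_of_nhds]
  have := hloc.apply_eq_of_isPreconnected isPreconnected_univ (Set.mem_univ (1 : unitInterval))
    (Set.mem_univ (0 : unitInterval))
  simpa using this

lemma isAnalyticContinuation_of_jet {p q : ℂ} {γ : Path p q} {F : unitInterval → ℂ → Mat}
    (hF : ∀ t, X.IsJetAt (F t) (γ t)) (hFc : ∀ t, ∀ᶠ s in 𝓝 t, F s =ᶠ[𝓝 (γ s)] F t) :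
    IsAnalyticContinuation γ fun t z => F t z 0 := by
  refine ⟨fun t => ?_, fun t => ?_⟩
  · refine Complex.analyticAt_iff_eventually_differentiableAt.2 ?_
    filter_upwards [hF t] with z hz
    exact differentiableAt_pi.2 fun i => (hasDerivAt_matrix.1 hz 0 i).differentiableAt
  · filter_upwards [hFc t] with s hs
    filter_upwards [hs] with z hz
    rw [hz]

end Continuation

/-- Analytic continuation along a path is unique. -/
lemma IsAnalyticContinuation.eventuallyEq {p q : ℂ} {γ : Path p q}
    {F G : unitInterval → ℂ → Fin 4 → ℂ} (hF : IsAnalyticContinuation γ F)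
    (hG : IsAnalyticContinuation γ G) (h : F 0 =ᶠ[𝓝 p] G 0) : F 1 =ᶠ[𝓝 q] G 1 := by
  set S : Set unitInterval := {t | F t =ᶠ[𝓝 (γ t)] G t} with hS
  have hopen : IsOpen S := by
    refine isOpen_iff_mem_nhds.2 fun t ht => ?_
    filter_upwards [hF.compatible t, hG.compatible t,
      γ.continuous.continuousAt.eventually (Eventually.eventually_nhds ht)] with s h1 h2 h3
    exact h1.trans (EventuallyEq.trans (show F t =ᶠ[𝓝 (γ s)] G t from h3) h2.symm)
  -- At a limit parameter t both germs are analytic on one disc around γ t, and this disc contains γ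
  -- s for some s in S close to t. The identity theorem spreads the agreement near γ s over the
  -- disc.
  have hclosed : IsClosed S := by
    refine isClosed_iff_frequently.2 fun t ht => ?_
    obtain ⟨ε, hε, hball⟩ := Metric.eventually_nhds_iff_ball.1
      ((hF.analytic t).eventually_analyticAt.and (hG.analytic t).eventually_analyticAt)
    obtain ⟨s, hs, h1, h2, h3⟩ := (ht.and_eventually ((hF.compatible t).and
      ((hG.compatible t).and (γ.continuous.continuousAt.eventually
        (Metric.ball_mem_nhds (γ t) hε))))).exists
    have h4 : F t =ᶠ[𝓝 (γ s)] G t := h1.symm.trans (EventuallyEq.trans hs h2)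
    have := AnalyticOnNhd.eqOn_of_preconnected_of_eventuallyEq (fun z hz => (hball z hz).1)
      (fun z hz => (hball z hz).2) (convex_ball (γ t) ε).isPreconnected h3 h4
    exact this.eventuallyEq_of_mem (Metric.ball_mem_nhds _ hε)
  have huniv : S = Set.univ := IsClopen.eq_univ ⟨hclosed, hopen⟩ ⟨0, by simpa [hS] using h⟩
  have h1 : (1 : unitInterval) ∈ S := huniv ▸ Set.mem_univ _
  simpa [hS] using h1

/-! ### Logarithmic factors exp(b log ξ) -/

section Logarithms

lemma hasDerivAt_logBranch {p : ℂ} (hp : p ≠ 0) (ℓ : ℂ) :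
    ∀ᶠ z in 𝓝 p, HasDerivAt (logBranch p ℓ) z⁻¹ z := by
  have hc : ContinuousAt (fun z : ℂ => z / p) p := by fun_prop
  have h1 : ∀ᶠ z in 𝓝 p, z / p ∈ Complex.slitPlane :=
    hc.eventually (Complex.isOpen_slitPlane.mem_nhds (by simp [hp]))
  filter_upwards [h1, isOpen_ne.mem_nhds hp] with z hz hz0
  have hz0 : z ≠ 0 := hz0
  have h2 := ((Complex.hasDerivAt_log hz).comp z ((hasDerivAt_id z).div_const p)).const_add ℓ
  refine h2.congr_deriv ?_
  field_simp

lemma logBranch_exp (w₀ : ℂ) :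
    ∀ᶠ w in 𝓝 w₀, logBranch (Complex.exp w₀) w₀ (Complex.exp w) = w := by
  have hc : ContinuousAt (fun w : ℂ => (w - w₀).im) w₀ := by fun_prop
  have h0 : (w₀ - w₀).im ∈ Set.Ioo (-Real.pi) Real.pi := by
    simp [Real.pi_pos]
  filter_upwards [hc.eventually (isOpen_Ioo.mem_nhds h0)] with w hw
  rw [logBranch, ← Complex.exp_sub, Complex.log_exp hw.1 hw.2.le]
  ring

variable {𝔸 : Type*} [NormedRing 𝔸] [NormedAlgebra ℂ 𝔸]

/-- The exponential of `lam • b`, for `b ^ 4 = 0`. -/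
def logExp (b : 𝔸) (lam : ℂ) : 𝔸 :=
  1 + lam • b + (lam ^ 2 / 2) • b ^ 2 + (lam ^ 3 / 6) • b ^ 3

lemma hasDerivAt_logExp {b : 𝔸} (hb : b ^ 4 = 0) {lam : ℂ → ℂ} {lam' z : ℂ}
    (h : HasDerivAt lam lam' z) :
    HasDerivAt (fun z => logExp b (lam z)) (lam' • (b * logExp b (lam z))) z := by
  have h1 := (((h.smul_const b).const_add 1).add (((h.pow 2).div_const 2).smul_const (b ^ 2))).add
    (((h.pow 3).div_const 6).smul_const (b ^ 3))
  refine h1.congr_deriv ?_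
  have e1 : b * logExp b (lam z) = b + lam z • b ^ 2 + (lam z ^ 2 / 2) • b ^ 3 := by
    simp only [logExp, mul_add, mul_one, mul_smul_comm, ← pow_succ', ← sq]
    simp [hb]
  rw [e1, smul_add, smul_add, smul_smul, smul_smul]
  congr 2
  · congr 1
    ring
  · ring_nf

/-- The logarithmic solutions `F exp(b log ξ)` of a singular system, in terms of a coordinate
`ξ`. -/
lemma hasDerivAt_mul_logExp {F A : ℂ → 𝔸} {b : 𝔸} (hb : b ^ 4 = 0) {r : ℝ}
    (hFd : DifferentiableOn ℂ F (Metric.ball 0 r))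
    (hF : ∀ x ∈ Metric.ball (0 : ℂ) r, x • deriv F x = A x * F x - F x * b)
    {ξ lam : ℂ → ℂ} {ξ' z : ℂ} (hξ : HasDerivAt ξ ξ' z) (hξr : ξ z ∈ Metric.ball (0 : ℂ) r)
    (hξ0 : ξ z ≠ 0) (hlam : HasDerivAt lam (ξ' / ξ z) z) :
    HasDerivAt (fun z => F (ξ z) * logExp b (lam z))
      ((ξ' / ξ z) • (A (ξ z) * (F (ξ z) * logExp b (lam z)))) z := by
  have h1 := (hFd.differentiableAt (Metric.isOpen_ball.mem_nhds hξr)).hasDerivAt.scomp z hξ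
  refine (h1.mul (hasDerivAt_logExp hb hlam)).congr_deriv ?_
  have h2 : deriv F (ξ z) = (ξ z)⁻¹ • (A (ξ z) * F (ξ z) - F (ξ z) * b) := by
    rw [← hF _ hξr, smul_smul, inv_mul_cancel₀ hξ0, one_smul]
  rw [h2, smul_smul, ← div_eq_mul_inv, mul_smul_comm, smul_mul_assoc, ← smul_add, sub_mul]
  congr 1
  simp only [Function.comp_apply, mul_assoc]
  abel

end Logarithms

/-- Both coefficient matrices have this shape, a simple pole 1 / (1 - ρ x) plus a polynomial of
degree at most two, with ρ = 1 / μ at z = 0 and ρ = 1 at the conifold. -/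
lemma hasSum_geometric_add {E : Type*} [NormedAddCommGroup E] [NormedSpace ℂ E] {K : E}
    {P : ℕ → E} (hP : ∀ k, 3 ≤ k → P k = 0) {ρ x : ℂ} (hx : ‖ρ * x‖ < 1) :
    HasSum (fun k => x ^ k • (ρ ^ k • K + P k))
      ((1 - ρ * x)⁻¹ • K + (P 0 + x • P 1 + x ^ 2 • P 2)) := by
  have h1 := (hasSum_geometric_of_norm_lt_one hx).smul_const K
  have h2 : HasSum (fun k => x ^ k • P k) (∑ k ∈ Finset.range 3, x ^ k • P k) :=
    hasSum_sum_of_ne_finset_zero fun k hk => by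
      rw [hP k (by simpa using hk), smul_zero]
  have h3 := h1.add h2
  simp only [Finset.sum_range_succ, Finset.sum_range_zero, zero_add, pow_zero, one_smul, pow_one]
    at h3
  refine h3.congr_fun ?_
  intro k
  rw [smul_add, smul_smul, mul_pow, mul_comm]

/-! ### Asymptotics in s = -log x as s → ∞ -/

section Asymptotics

lemma tendsto_exp_neg_mul_pow (k : ℕ) :
    Tendsto (fun s : ℝ => Complex.exp (-s) * (s : ℂ) ^ k) atTop (𝓝 0) := by
  have h := (Complex.continuous_ofReal.tendsto 0).comp
    (Real.tendsto_pow_mul_exp_neg_atTop_nhds_zero k)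
  rw [Complex.ofReal_zero] at h
  refine h.congr fun s => ?_
  simp [mul_comm]

lemma tendsto_exp_neg : Tendsto (fun s : ℝ => Complex.exp (-s)) atTop (𝓝 0) := by
  simpa using tendsto_exp_neg_mul_pow 0

/-- For x = exp(-s), the factor exp(s)ⁿ divides by xⁿ, and the remaining power of x beats every
power of s = -log x. -/
lemma tendsto_of_isBigO_pow {h : ℂ → ℂ} {n : ℕ} (hh : h =O[𝓝 0] fun x => x ^ (n + 1)) (k : ℕ) :
    Tendsto (fun s : ℝ => h (Complex.exp (-s)) * Complex.exp s ^ n * (s : ℂ) ^ k) atTop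
      (𝓝 0) := by
  have h1 := hh.comp_tendsto tendsto_exp_neg
  have h2 : (fun s : ℝ => h (Complex.exp (-s)) * Complex.exp s ^ n * (s : ℂ) ^ k) =O[atTop]
      fun s : ℝ => Complex.exp (-s) ^ (n + 1) * Complex.exp s ^ n * (s : ℂ) ^ k :=
    (h1.mul (isBigO_refl _ _)).mul (isBigO_refl _ _)
  refine h2.trans_tendsto ((tendsto_exp_neg_mul_pow k).congr fun s => ?_)
  have e : Complex.exp (-s) ^ n * Complex.exp s ^ n = 1 := by
    rw [← mul_pow, ← Complex.exp_add]
    simp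
  linear_combination (-(Complex.exp (-s) * (s : ℂ) ^ k)) * e

/-- The difference f(s + 1) - f(s) keeps the limit 0 and lowers the degree; three, two and one
differences isolate 6 a₃, 2 a₂ and a₁ in turn. -/
lemma eq_zero_of_tendsto_cubic {a₀ a₁ a₂ a₃ : ℂ}
    (h : Tendsto (fun s : ℝ => a₀ + a₁ * s + a₂ * (s : ℂ) ^ 2 + a₃ * (s : ℂ) ^ 3) atTop (𝓝 0)) :
    a₀ = 0 ∧ a₁ = 0 ∧ a₂ = 0 ∧ a₃ = 0 := by
  have shift : ∀ {f : ℝ → ℂ}, Tendsto f atTop (𝓝 0) →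
      Tendsto (fun s => f (s + 1) - f s) atTop (𝓝 0) := fun hf => by
    simpa using (hf.comp (tendsto_atTop_add_const_right atTop (1 : ℝ) tendsto_id)).sub hf
  have lim : ∀ {f : ℝ → ℂ} {c : ℂ}, Tendsto f atTop (𝓝 0) → (∀ s, f s = c) → c = 0 :=
    fun hf hc => tendsto_nhds_unique (tendsto_const_nhds.congr fun s => (hc s).symm) hf
  have h3 : a₃ = 0 := by
    have h1 := lim (c := 6 * a₃) (shift (shift (shift h))) fun s => by push_cast; ring
    simpa using h1
  subst h3
  have h2 : a₂ = 0 := by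
    have h1 := lim (c := 2 * a₂) (shift (shift h)) fun s => by push_cast; ring
    simpa using h1
  subst h2
  have h1 : a₁ = 0 := lim (shift h) fun s => by push_cast; ring
  subst h1
  exact ⟨lim h fun s => by ring, rfl, rfl, rfl⟩

end Asymptotics

/-! ### The Frobenius basis at z = 0 -/

section MUM

attribute [local instance] Matrix.linftyOpNormedRing Matrix.linftyOpNormedAlgebra

/-- The nilpotent residue at `z = 0`. -/
def mumResidue : Mat :=
  !![0, 1, 0, 0; 0, 0, 1, 0; 0, 0, 0, 1; 0, 0, 0, 0]

lemma mumResidue_pow_four : mumResidue ^ 4 = 0 := by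
  have h2 : mumResidue ^ 2 = !![0, 0, 1, 0; 0, 0, 0, 1; 0, 0, 0, 0; 0, 0, 0, 0] := by
    rw [sq]; ext i j
    fin_cases i <;> fin_cases j <;> simp [mumResidue, Matrix.mul_apply, Fin.sum_univ_four]
  have h4 : mumResidue ^ 4 = mumResidue ^ 2 * mumResidue ^ 2 := by rw [← pow_add]
  rw [h4, h2]
  ext i j
  fin_cases i <;> fin_cases j <;> simp [Matrix.mul_apply, Fin.sum_univ_four]

lemma logExp_mumResidue (l : ℂ) : logExp mumResidue l =
    !![1, l, l ^ 2 / 2, l ^ 3 / 6; 0, 1, l, l ^ 2 / 2; 0, 0, 1, l; 0, 0, 0, 1] := by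
  have h2 : mumResidue ^ 2 = !![0, 0, 1, 0; 0, 0, 0, 1; 0, 0, 0, 0; 0, 0, 0, 0] := by
    rw [sq]; ext i j
    fin_cases i <;> fin_cases j <;> simp [mumResidue, Matrix.mul_apply, Fin.sum_univ_four]
  have h3 : mumResidue ^ 3 = !![0, 0, 0, 1; 0, 0, 0, 0; 0, 0, 0, 0; 0, 0, 0, 0] := by
    rw [pow_succ, h2]; ext i j
    fin_cases i <;> fin_cases j <;> simp [mumResidue, Matrix.mul_apply, Fin.sum_univ_four]
  rw [logExp, h2, h3]
  ext i j
  fin_cases i <;> fin_cases j <;> simp [mumResidue]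

/-- The factorials and powers of log z in Π₀ are those of exp(N log z), so the fⱼ are the first row
of the holomorphic factor F, and F(0) = 1 is their normalization. -/
lemma mul_logExp_mumResidue_row (M : Mat) (l : ℂ) :
    (M * logExp mumResidue l) 0 = mumVector (fun j _ => M 0 j) (fun _ => l) 0 := by
  rw [logExp_mumResidue]
  ext j
  rw [Matrix.mul_apply]
  fin_cases j <;> simp [mumVector, Fin.sum_univ_four] <;> ring

/-- At t = 0, `companion_pairing` says that the residue is skew for the form, so its exponentials
are isometries and the logarithms leave no trace in the Gram matrix. -/
lemma mum_pairing_logExp (e₂ l : ℂ) :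
    (logExp mumResidue l).transpose * pairing e₂ 0 * logExp mumResidue l = pairing e₂ 0 := by
  rw [logExp_mumResidue]
  ext i j
  simp only [Matrix.mul_apply, Fin.sum_univ_four]
  fin_cases i <;> fin_cases j <;> simp [pairing] <;> ring

variable {X : Data}

/-- A Frobenius basis at `z = 0`, together with its jets. -/
lemma exists_mum (h : X.IsSelfDual) : ∃ f, X.IsMUMFrobenius f ∧
    ∀ p ℓ : ℂ, 0 < ‖p‖ → ‖p‖ < ‖X.mu‖ → Complex.exp ℓ = p →
      ∃ U, X.IsJetAt U p ∧ (∀ z, U z 0 = mumVector f (logBranch p ℓ) z) ∧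
        X.jetPairing U U p = pairing X.e₂ 0 := by
  set r := ‖X.mu‖ with hr
  have hr0 : 0 < r := norm_pos_iff.2 h.mu_ne
  set K : Mat := !![0, 0, 0, 0; 0, 0, 0, 0; 0, 0, 0, 0; X.e₄, X.e₂ - 1, X.e₂, 2] with hK
  set P : ℕ → Mat := fun k => if k = 0 then mumResidue - K else 0 with hP
  set A : ℂ → Mat := fun z => companion X.e₂ X.e₄ (z / X.mu) with hA
  have hlt : ∀ x ∈ Metric.ball (0 : ℂ) r, ‖X.mu⁻¹ * x‖ < 1 := fun x hx => by
    rw [norm_mul, norm_inv, inv_mul_lt_one₀ hr0]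
    simpa using hx
  have hne : ∀ x ∈ Metric.ball (0 : ℂ) r, 1 - x / X.mu ≠ 0 := fun x hx h0 => by
    have h1 := hlt x hx
    rw [mul_comm, ← div_eq_mul_inv, ← sub_eq_zero.1 h0] at h1
    simp at h1
  have hsum : ∀ x ∈ Metric.ball (0 : ℂ) r,
      HasSum (fun k => x ^ k • (X.mu⁻¹ ^ k • K + P k)) (A x) := fun x hx => by
    have h1 := hasSum_geometric_add (K := K) (P := P)
      (fun k hk => by simp [hP, show k ≠ 0 by omega]) (hlt x hx)
    have h2 := hne x hx
    have h3 : X.mu⁻¹ * x = x / X.mu := by rw [mul_comm, div_eq_mul_inv]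
    suffices e : (1 - X.mu⁻¹ * x)⁻¹ • K + (P 0 + x • P 1 + x ^ 2 • P 2) = A x by rwa [e] at h1
    rw [h3]
    have hAx : A x = companion X.e₂ X.e₄ (x / X.mu) := rfl
    rw [hAx]
    generalize x / X.mu = t at h2
    ext i j
    fin_cases i <;> fin_cases j <;> simp [hP, hK, companion, mumResidue] <;> field_simp <;> ring
  have ha0 : X.mu⁻¹ ^ 0 • K + P 0 = mumResidue := by simp [hP]
  obtain ⟨c, F, hc0, -, hcF, hFd, hF⟩ := exists_frobenius_solution
    (a := fun k => X.mu⁻¹ ^ k • K + P k) (b := mumResidue) (c₀ := 1)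
    (by rw [ha0]; exact ⟨4, mumResidue_pow_four⟩) ⟨4, mumResidue_pow_four⟩
    (by rw [ha0, one_mul, mul_one]) hsum
  have h0 : (0 : ℂ) ∈ Metric.ball (0 : ℂ) r := by simpa using hr0
  have hF0 : F 0 = 1 := by
    have h1 := hasSum_single (f := fun k => (0 : ℂ) ^ k • c k) 0 fun k hk => by simp [hk]
    rw [(hcF 0 h0).unique h1]
    simp [hc0]
  have hjet : ∀ p ℓ : ℂ, 0 < ‖p‖ → ‖p‖ < r → Complex.exp ℓ = p →
      X.IsJetAt (fun z => F z * logExp mumResidue (logBranch p ℓ z)) p := by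
    intro p ℓ hp hpr hℓ
    have hp0 : p ≠ 0 := norm_pos_iff.1 hp
    filter_upwards [hasDerivAt_logBranch hp0 ℓ, isOpen_ne.mem_nhds hp0,
      Metric.isOpen_ball.mem_nhds (show p ∈ Metric.ball (0 : ℂ) r by simpa using hpr)]
      with z h1 h2 h3
    have h4 := hasDerivAt_mul_logExp (ξ := fun z => z) mumResidue_pow_four hFd hF (hasDerivAt_id z)
      h3 h2 (h1.congr_deriv (by rw [one_div]))
    exact h4.congr_deriv (by rw [one_div])
  have hrow : ∀ (p ℓ z : ℂ), (F z * logExp mumResidue (logBranch p ℓ z)) 0 =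
      mumVector (fun j z => F z 0 j) (logBranch p ℓ) z := fun p ℓ z =>
    mul_logExp_mumResidue_row _ _
  have hpne : ∀ p : ℂ, ‖p‖ < r → X.delta p ≠ 0 := fun p hp => hne p (by simpa using hp)
  refine ⟨fun j z => F z 0 j, ⟨fun j => ?_, ?_, ?_, ?_, ?_, fun p ℓ hp hpr hℓ i => ?_⟩,
    fun p ℓ hp hpr hℓ => ⟨_, hjet p ℓ hp hpr hℓ, hrow p ℓ, ?_⟩⟩
  · refine DifferentiableOn.analyticOnNhd (fun z hz => ?_) Metric.isOpen_ball
    exact (hasDerivAt_matrix.1 (hFd.differentiableAt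
      (Metric.isOpen_ball.mem_nhds hz)).hasDerivAt 0 j).differentiableAt.differentiableWithinAt
  · simp [hF0]
  · simp [hF0]
  · simp [hF0]
  · simp [hF0]
  · have h1 := (hjet p ℓ hp hpr hℓ).isSolutionAt h (norm_pos_iff.1 hp) (hpne p hpr) i
    simpa only [hrow] using h1
  · have hpball : p ∈ Metric.ball (0 : ℂ) r := by simpa using hpr
    have h1 := frobenius_pairing_eq (Q := fun z => pairing X.e₂ (z / X.mu))
      (Q' := fun _ => X.mu⁻¹ • pairingDeriv X.e₂) ⟨4, mumResidue_pow_four⟩ hFd hF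
      (fun x _ => by
        exact ((hasDerivAt_pairing X.e₂ (x / X.mu)).scomp x
          ((hasDerivAt_id x).div_const X.mu)).congr_deriv (by rw [one_div]))
      (fun x hx => by
        rw [smul_smul, ← div_eq_mul_inv]
        exact companion_pairing X.e₂ X.e₄ (hne x hx)) hpball
    simp only [hF0, zero_div, Matrix.transpose_one, one_mul, mul_one] at h1
    rw [Data.jetPairing, Matrix.transpose_mul]
    have h2 := mum_pairing_logExp X.e₂ (logBranch p ℓ p)
    rw [← h1] at h2
    rw [← h1]
    simpa only [mul_assoc] using h2

end MUM

/-! ### Relations between solutions in the coordinate w = log z -/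

section HalfPlane

/-- The half-plane is the universal cover of the punctured disc: there the logarithm is
single-valued, and a relation known near one point reaches the region re w → -∞, where the
normalizations can be compared. -/
lemma eq_sum_on_halfPlane {R : ℝ} {Y : ℂ → Fin 4 → ℂ} {y : ℂ → ℂ}
    (hY : ∀ i, ∀ w : ℂ, w.re < R → DifferentiableAt ℂ (fun w => Y w i) w)
    (hy : ∀ w : ℂ, w.re < R → DifferentiableAt ℂ y w) {c : Fin 4 → ℂ} {w₀ : ℂ} (hw₀ : w₀.re < R)
    (h : ∀ᶠ w in 𝓝 w₀, y w = ∑ i, c i * Y w i) {w : ℂ} (hw : w.re < R) :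
    y w = ∑ i, c i * Y w i := by
  have hopen : IsOpen {w : ℂ | w.re < R} := isOpen_lt Complex.continuous_re continuous_const
  have h1 : AnalyticOnNhd ℂ y {w : ℂ | w.re < R} :=
    DifferentiableOn.analyticOnNhd (fun w hw => (hy w hw).differentiableWithinAt) hopen
  have h2 : AnalyticOnNhd ℂ (fun w => ∑ i, c i * Y w i) {w : ℂ | w.re < R} :=
    DifferentiableOn.analyticOnNhd (fun w hw => (DifferentiableAt.fun_sum fun i _ =>
      (hY i w hw).const_mul (c i)).differentiableWithinAt) hopen
  exact h1.eqOn_of_preconnected_of_eventuallyEq h2 (convex_halfSpace_re_lt R).isPreconnected hw₀ h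
    hw

/-- A germ of a function near `exp w₀` involving a branch of the logarithm, in terms of the
logarithm. -/
lemma eventually_comp_exp {w₀ : ℂ} {P : ℂ → ℂ → Prop}
    (h : ∀ᶠ z in 𝓝 (Complex.exp w₀), P z (logBranch (Complex.exp w₀) w₀ z)) :
    ∀ᶠ w in 𝓝 w₀, P (Complex.exp w) w := by
  filter_upwards [Complex.continuous_exp.continuousAt.eventually h, logBranch_exp w₀] with w h1 h2
  rwa [h2] at h1

lemma isBigO_pow_zero {h : ℂ → ℂ} {n : ℕ} (hh : h =O[𝓝 0] fun x => x ^ (n + 1)) : h 0 = 0 := by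
  obtain ⟨C, hC⟩ := hh.bound
  simpa using hC.self_of_nhds

end HalfPlane

/-! ### Uniqueness of the Frobenius basis at z = 0 -/

section MUMUniqueness

variable {X : Data}

lemma differentiableAt_mumVector {f : Fin 4 → ℂ → ℂ} (hf : X.IsMUMFrobenius f) (i : Fin 4) {w : ℂ}
    (hw : ‖Complex.exp w‖ < ‖X.mu‖) :
    DifferentiableAt ℂ (fun w => mumVector f (fun _ => w) (Complex.exp w) i) w := by
  have h : ∀ j, DifferentiableAt ℂ (fun w => f j (Complex.exp w)) w := fun j =>
    (hf.analytic j _ (by simpa using hw)).differentiableAt.comp w Complex.differentiableAt_exp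
  have hid : DifferentiableAt ℂ (fun w : ℂ => w) w := differentiableAt_id
  fin_cases i
  · exact h 0
  · exact ((h 0).fun_mul hid).fun_add (h 1)
  · exact ((((h 0).const_mul (1 / 2)).fun_mul (hid.fun_pow 2)).fun_add
      ((h 1).fun_mul hid)).fun_add (h 2)
  · exact (((((h 0).const_mul (1 / 6)).fun_mul (hid.fun_pow 3)).fun_add
      (((h 1).const_mul (1 / 2)).fun_mul (hid.fun_pow 2))).fun_add
      ((h 2).fun_mul hid)).fun_add (h 3)

/-- The leading behaviour of the Frobenius basis, for `w = log z → -∞`. -/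
def mumLeading (s : ℝ) : Fin 4 → ℂ := ![1, -s, s ^ 2 / 2, -s ^ 3 / 6]

lemma tendsto_mumVector {f : Fin 4 → ℂ → ℂ} (hμ : X.mu ≠ 0) (hf : X.IsMUMFrobenius f) (i : Fin 4) :
    Tendsto (fun s : ℝ => mumVector f (fun _ => -(s : ℂ)) (Complex.exp (-s)) i - mumLeading s i)
      atTop (𝓝 0) := by
  have hO : ∀ j, (fun x => f j x - f j 0) =O[𝓝 0] fun x : ℂ => x ^ (0 + 1) := fun j => by
    have h1 := (hf.analytic j 0 (by simpa using hμ)).differentiableAt.isBigO_sub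
    simpa using h1
  have h0 := hO 0
  have h1 := hO 1
  have h2 := hO 2
  have h3 := hO 3
  rw [hf.f_zero] at h0
  rw [hf.f_one] at h1
  rw [hf.f_two] at h2
  rw [hf.f_three] at h3
  have t := fun {h : ℂ → ℂ} (hh : h =O[𝓝 0] fun x : ℂ => x ^ (0 + 1)) (k : ℕ) =>
    tendsto_of_isBigO_pow hh k
  fin_cases i
  · refine (t h0 0).congr fun s => ?_
    simp [mumVector, mumLeading]
  · have := ((t h0 1).const_mul (-1)).add (t h1 0)
    rw [mul_zero, add_zero] at this
    refine this.congr fun s => ?_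
    simp [mumVector, mumLeading]
    ring
  · have := (((t h0 2).const_mul (1 / 2)).add ((t h1 1).const_mul (-1))).add (t h2 0)
    simp only [mul_zero, add_zero] at this
    refine this.congr fun s => ?_
    simp [mumVector, mumLeading]
    ring
  · have := ((((t h0 3).const_mul (-1 / 6)).add ((t h1 2).const_mul (1 / 2))).add
      ((t h2 1).const_mul (-1))).add (t h3 0)
    simp only [mul_zero, add_zero] at this
    refine this.congr fun s => ?_
    simp [mumVector, mumLeading]
    ring

/-- A component of the second basis is a combination of the first basis. Along w = -s both sides
reduce to their leading terms, multiples of 1, s, s², s³, so the combination is trivial. Equality of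
the vectors then yields f₀, f₁, f₂, f₃ successively. -/
lemma mum_unique (h : X.IsSelfDual) {f f' : Fin 4 → ℂ → ℂ} (hf : X.IsMUMFrobenius f)
    (hf' : X.IsMUMFrobenius f')
    (hbasis : ∀ p ℓ : ℂ, 0 < ‖p‖ → ‖p‖ < ‖X.mu‖ → Complex.exp ℓ = p →
      X.IsSolutionBasisAt (mumVector f (logBranch p ℓ)) p) :
    ∀ j, Set.EqOn (f' j) (f j) (Metric.ball 0 ‖X.mu‖) := by
  have hr0 : 0 < ‖X.mu‖ := norm_pos_iff.2 h.mu_ne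
  set R := Real.log ‖X.mu‖ with hR
  have hexp : ∀ w : ℂ, w.re < R → ‖Complex.exp w‖ < ‖X.mu‖ := fun w hw => by
    rw [Complex.norm_exp, ← Real.lt_log_iff_exp_lt hr0]
    exact hw
  set w₀ : ℂ := ((R - 1 : ℝ) : ℂ) with hw₀
  have hw₀R : w₀.re < R := by rw [hw₀, Complex.ofReal_re]; linarith
  have hY : ∀ w : ℂ, w.re < R → ∀ j, mumVector f' (fun _ => w) (Complex.exp w) j =
      mumVector f (fun _ => w) (Complex.exp w) j := by
    intro w hw j
    have hp0 : 0 < ‖Complex.exp w₀‖ := norm_pos_iff.2 (Complex.exp_ne_zero _)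
    obtain ⟨c, hc, -⟩ := (hbasis _ w₀ hp0 (hexp w₀ hw₀R) rfl).2 _
      (hf'.solution _ w₀ hp0 (hexp w₀ hw₀R) rfl j)
    have hc' : ∀ᶠ w in 𝓝 w₀, mumVector f' (fun _ => w) (Complex.exp w) j =
        ∑ i, c i * mumVector f (fun _ => w) (Complex.exp w) i :=
      eventually_comp_exp (P := fun z l => mumVector f' (fun _ => l) z j =
        ∑ i, c i * mumVector f (fun _ => l) z i) hc
    have hall := fun {w : ℂ} (hw : w.re < R) => eq_sum_on_halfPlane
      (Y := fun w => mumVector f (fun _ => w) (Complex.exp w))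
      (fun i w hw => differentiableAt_mumVector hf i (hexp w hw))
      (fun w hw => differentiableAt_mumVector hf' j (hexp w hw)) hw₀R hc' hw
    have hlim : Tendsto (fun s : ℝ => ∑ i, c i * mumLeading s i - mumLeading s j) atTop (𝓝 0) := by
      have h1 := (tendsto_mumVector h.mu_ne hf' j).sub
        (tendsto_finsetSum Finset.univ fun i _ => (tendsto_mumVector h.mu_ne hf i).const_mul (c i))
      simp only [mul_zero, Finset.sum_const_zero, sub_zero] at h1
      refine h1.congr' ?_
      filter_upwards [eventually_gt_atTop (-R)] with s hs
      have h2 := hall (w := -(s : ℂ)) (by simpa using by linarith)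
      rw [h2]
      simp only [mul_sub, Finset.sum_sub_distrib]
      ring
    have hc1 : ∀ i, c i = if i = j then 1 else 0 := by
      simp only [Fin.sum_univ_four, mumLeading] at hlim
      fin_cases j
      · obtain ⟨e0, e1, e2, e3⟩ := eq_zero_of_tendsto_cubic (a₀ := c 0 - 1) (a₁ := -c 1)
          (a₂ := c 2 / 2) (a₃ := -c 3 / 6) (hlim.congr fun s => by simp; ring)
        intro i
        fin_cases i <;> simp <;> grind
      · obtain ⟨e0, e1, e2, e3⟩ := eq_zero_of_tendsto_cubic (a₀ := c 0) (a₁ := 1 - c 1)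
          (a₂ := c 2 / 2) (a₃ := -c 3 / 6) (hlim.congr fun s => by simp; ring)
        intro i
        fin_cases i <;> simp <;> grind
      · obtain ⟨e0, e1, e2, e3⟩ := eq_zero_of_tendsto_cubic (a₀ := c 0) (a₁ := -c 1)
          (a₂ := c 2 / 2 - 1 / 2) (a₃ := -c 3 / 6) (hlim.congr fun s => by simp; ring)
        intro i
        fin_cases i <;> simp <;> grind
      · obtain ⟨e0, e1, e2, e3⟩ := eq_zero_of_tendsto_cubic (a₀ := c 0) (a₁ := -c 1)
          (a₂ := c 2 / 2) (a₃ := 1 / 6 - c 3 / 6) (hlim.congr fun s => by simp; ring)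
        intro i
        fin_cases i <;> simp <;> grind
    rw [hall hw]
    simp [hc1]
  have hpt : ∀ x ∈ Metric.ball (0 : ℂ) ‖X.mu‖, ∀ j, f' j x = f j x := by
    intro x hx
    rcases eq_or_ne x 0 with rfl | hx0
    · intro j
      fin_cases j
      · exact hf'.f_zero.trans hf.f_zero.symm
      · exact hf'.f_one.trans hf.f_one.symm
      · exact hf'.f_two.trans hf.f_two.symm
      · exact hf'.f_three.trans hf.f_three.symm
    · have h1 := hY (Complex.log x) (by
        rw [Complex.log_re]
        exact Real.log_lt_log (norm_pos_iff.2 hx0) (by simpa using hx))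
      rw [Complex.exp_log hx0] at h1
      have a0 := h1 0
      have a1 := h1 1
      have a2 := h1 2
      have a3 := h1 3
      simp [mumVector] at a0 a1 a2 a3
      rw [a0] at a1 a2 a3
      have b1 := add_left_cancel a1
      rw [b1] at a2 a3
      have b2 := add_left_cancel a2
      rw [b2] at a3
      have b3 := add_left_cancel a3
      intro j
      fin_cases j
      exacts [a0, b1, b2, b3]
  exact fun j x hx => hpt x hx j

end MUMUniqueness

/-! ### The gauge-transformed system at the conifold point -/

section ConifoldSystem

attribute [local instance] Matrix.linftyOpNormedRing Matrix.linftyOpNormedAlgebra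

/-- The system of the hypergeometric equation in the variable `x = 1 - z / μ`, for the modified jets
`(y, θ y, θ² y - x θ³ y, x² θ³ y)`, in which its residue at `x = 0` is nilpotent. -/
def conifoldSystem (e₂ e₄ x : ℂ) : Mat :=
  !![0, -x / (1 - x), 0, 0;
     0, 0, -x / (1 - x), -1 / (1 - x);
     x * e₄, x * (e₂ - 1), x * e₂, e₂ - 1 / (1 - x);
     -x ^ 2 * e₄, -x ^ 2 * (e₂ - 1), -x ^ 2 * e₂, -x * e₂]

/-- The geometric part of the power series of `conifoldSystem`. -/
def conifoldGeometric : Mat :=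
  !![0, -1, 0, 0; 0, 0, -1, -1; 0, 0, 0, -1; 0, 0, 0, 0]

/-- The polynomial part of the power series of `conifoldSystem`. -/
def conifoldPolynomial (e₂ e₄ : ℂ) : ℕ → Mat
  | 0 => !![0, 1, 0, 0; 0, 0, 1, 0; 0, 0, 0, e₂; 0, 0, 0, 0]
  | 1 => !![0, 0, 0, 0; 0, 0, 0, 0; e₄, e₂ - 1, e₂, 0; 0, 0, 0, -e₂]
  | 2 => !![0, 0, 0, 0; 0, 0, 0, 0; 0, 0, 0, 0; -e₄, -(e₂ - 1), -e₂, 0]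
  | _ => 0

lemma one_sub_ne_of_mem_ball {x : ℂ} (hx : x ∈ Metric.ball (0 : ℂ) 1) : 1 - x ≠ 0 := fun h => by
  rw [← sub_eq_zero.1 h] at hx
  simp at hx

lemma hasSum_conifoldSystem (e₂ e₄ : ℂ) {x : ℂ} (hx : x ∈ Metric.ball (0 : ℂ) 1) :
    HasSum (fun k => x ^ k • ((1 : ℂ) ^ k • conifoldGeometric + conifoldPolynomial e₂ e₄ k))
      (conifoldSystem e₂ e₄ x) := by
  have h1 := hasSum_geometric_add (K := conifoldGeometric) (P := conifoldPolynomial e₂ e₄) (ρ := 1)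
    (fun k hk => by obtain ⟨m, rfl⟩ := Nat.exists_eq_add_of_le' hk; rfl)
    (x := x) (by simpa using hx)
  have hne := one_sub_ne_of_mem_ball hx
  suffices e : (1 - 1 * x)⁻¹ • conifoldGeometric + (conifoldPolynomial e₂ e₄ 0 +
      x • conifoldPolynomial e₂ e₄ 1 + x ^ 2 • conifoldPolynomial e₂ e₄ 2) =
      conifoldSystem e₂ e₄ x by
    rwa [e] at h1
  ext i j
  fin_cases i <;> fin_cases j <;>
    simp [conifoldSystem, conifoldGeometric, conifoldPolynomial] <;> field_simp <;> ring

/-- The logarithmic residue of the conifold basis: the fourth solution contains `log` times the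
second one. -/
def conifoldLog : Mat := !![0, 0, 0, 0; 0, 0, 0, 1; 0, 0, 0, 0; 0, 0, 0, 0]

lemma conifoldLog_sq : conifoldLog ^ 2 = 0 := by
  rw [sq]; ext i j
  fin_cases i <;> fin_cases j <;> simp [conifoldLog, Matrix.mul_apply, Fin.sum_univ_four]

lemma conifoldLog_pow_four : conifoldLog ^ 4 = 0 := pow_eq_zero_of_le (by norm_num) conifoldLog_sq

lemma logExp_conifoldLog (l : ℂ) : logExp conifoldLog l =
    !![1, 0, 0, 0; 0, 1, 0, l; 0, 0, 1, 0; 0, 0, 0, 1] := by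
  have h3 : conifoldLog ^ 3 = 0 := pow_eq_zero_of_le (by norm_num) conifoldLog_sq
  rw [logExp, conifoldLog_sq, h3]
  ext i j
  fin_cases i <;> fin_cases j <;> simp [conifoldLog]

/-- The modified jets at `x = 0` of the normalized conifold basis, without logarithmic terms. -/
def conifoldInitial (e₂ : ℂ) : Mat :=
  !![1, 0, 0, 0; 0, -1, 0, -1; 0, e₂ - 1, 2, 5 / 2 * e₂ - 3; 0, 0, 0, 1]

/-- The invariant form on modified jets. -/
def conifoldJetForm (e₂ x : ℂ) : Mat :=
  !![0, (1 - e₂) * (1 - x), -(1 - x), 1;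
     -((1 - e₂) * (1 - x)), 0, -x, -1;
     1 - x, x, 0, 0;
     -1, 1, 0, 0]

/-- The derivative of `conifoldJetForm`. -/
def conifoldJetFormDeriv (e₂ : ℂ) : Mat :=
  !![0, -(1 - e₂), 1, 0; 1 - e₂, 0, -1, 0; -1, 1, 0, 0; 0, 0, 0, 0]

lemma hasDerivAt_conifoldJetForm (e₂ x : ℂ) :
    HasDerivAt (conifoldJetForm e₂) (conifoldJetFormDeriv e₂) x := by
  have e : ∀ x, conifoldJetForm e₂ x = conifoldJetForm e₂ 0 + x • conifoldJetFormDeriv e₂ := by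
    intro x
    ext i j
    fin_cases i <;> fin_cases j <;> simp [conifoldJetForm, conifoldJetFormDeriv] <;> ring
  have h1 := ((hasDerivAt_id x).smul_const (conifoldJetFormDeriv e₂)).const_add
    (conifoldJetForm e₂ 0)
  rw [one_smul] at h1
  exact h1.congr_of_eventuallyEq (Eventually.of_forall e)

/-- Off x = 0 this is `companion_pairing` in the new gauge, but the Frobenius argument needs it at x
= 0 too, where the gauge is singular. -/
lemma conifoldSystem_form (e₂ e₄ : ℂ) {x : ℂ} (hx : 1 - x ≠ 0) :
    (conifoldSystem e₂ e₄ x).transpose * conifoldJetForm e₂ x + x • conifoldJetFormDeriv e₂ +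
      conifoldJetForm e₂ x * conifoldSystem e₂ e₄ x = 0 := by
  ext i j
  simp only [Matrix.add_apply, Matrix.mul_apply, Fin.sum_univ_four, Matrix.transpose_apply]
  fin_cases i <;> fin_cases j <;>
    simp [conifoldSystem, conifoldJetForm, conifoldJetFormDeriv] <;> field_simp <;> ring

/-- The invariant form in the conifold basis. -/
def conifoldGram (e₂ : ℂ) : Mat :=
  !![0, 0, -2, 3 / 2 * (2 - e₂); 0, 0, 0, 1; 2, 0, 0, 0; -(3 / 2 * (2 - e₂)), -1, 0, 0]

/-- The result does not depend on l because `conifoldLog` is skew for the Gram matrix. The entry 3/2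
(2 - e₂) is 2α. -/
lemma conifoldInitial_form (e₂ l : ℂ) :
    (conifoldInitial e₂ * logExp conifoldLog l).transpose * conifoldJetForm e₂ 0 *
      (conifoldInitial e₂ * logExp conifoldLog l) = conifoldGram e₂ := by
  have e : conifoldInitial e₂ * logExp conifoldLog l =
      !![1, 0, 0, 0; 0, -1, 0, -1 - l; 0, e₂ - 1, 2, 5 / 2 * e₂ - 3 + (e₂ - 1) * l; 0, 0, 0, 1] := by
    rw [logExp_conifoldLog]
    ext i j
    rw [Matrix.mul_apply]
    fin_cases i <;> fin_cases j <;> simp [conifoldInitial, Fin.sum_univ_four] <;> ring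
  rw [e]
  ext i j
  simp only [Matrix.mul_apply, Fin.sum_univ_four, Matrix.transpose_apply]
  fin_cases i <;> fin_cases j <;> simp [conifoldJetForm, conifoldGram] <;> ring

/-- The matrix that takes modified jets to jets. -/
def conifoldGauge (x : ℂ) : Mat :=
  !![1, 0, 0, 0; 0, 1, 0, 0; 0, 0, 1, x⁻¹; 0, 0, 0, (x ^ 2)⁻¹]

/-- The derivative of `conifoldGauge`. -/
def conifoldGaugeDeriv (x : ℂ) : Mat :=
  !![0, 0, 0, 0; 0, 0, 0, 0; 0, 0, 0, -(x ^ 2)⁻¹; 0, 0, 0, -2 * (x ^ 3)⁻¹]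

lemma hasDerivAt_conifoldGauge {x : ℂ} (hx : x ≠ 0) :
    HasDerivAt conifoldGauge (conifoldGaugeDeriv x) x := by
  have h1 : HasDerivAt (fun x : ℂ => x⁻¹) (-(x ^ 2)⁻¹) x := hasDerivAt_inv hx
  have h2 : HasDerivAt (fun x : ℂ => (x ^ 2)⁻¹) (-2 * (x ^ 3)⁻¹) x :=
    ((hasDerivAt_pow 2 x).inv (pow_ne_zero 2 hx)).congr_deriv (by field_simp; ring)
  refine hasDerivAt_matrix.2 fun i j => ?_
  fin_cases i <;> fin_cases j
  all_goals first
    | exact hasDerivAt_const x _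
    | exact h1
    | exact h2

/-- For t = 1 - x one has θ = -(1 - x) d/dx, so this says that G m solves the companion system
whenever x m' equals `conifoldSystem` times m. -/
lemma conifoldGauge_system (e₂ e₄ : ℂ) {x : ℂ} (hx : x ≠ 0) (hx' : 1 - x ≠ 0) :
    -(1 - x) • (conifoldGaugeDeriv x + x⁻¹ • (conifoldGauge x * conifoldSystem e₂ e₄ x)) =
      companion e₂ e₄ (1 - x) * conifoldGauge x := by
  ext i j
  simp only [Matrix.add_apply, Matrix.mul_apply, Fin.sum_univ_four, Matrix.smul_apply]
  fin_cases i <;> fin_cases j <;>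
    simp [conifoldGaugeDeriv, conifoldGauge, conifoldSystem, companion] <;> field_simp <;>
    first | ring1 | (ring_nf; simp)

/-- The poles of the gauge cancel against the vanishing of the form at t = 1; in determinants,
(x⁻²)² against x⁴. The form on modified jets is therefore polynomial and nondegenerate also at x =
0. -/
lemma conifoldGauge_form (e₂ : ℂ) {x : ℂ} (hx : x ≠ 0) :
    (conifoldGauge x).transpose * pairing e₂ (1 - x) * conifoldGauge x = conifoldJetForm e₂ x := by
  ext i j
  simp only [Matrix.mul_apply, Fin.sum_univ_four, Matrix.transpose_apply]
  fin_cases i <;> fin_cases j <;>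
    simp [conifoldGauge, conifoldJetForm, pairing] <;> field_simp <;> ring

/-- The Taylor coefficients of the conifold basis up to second order. -/
lemma conifold_coeff {e₂ e₄ : ℂ} {c : ℕ → Mat} (hc0 : c 0 = conifoldInitial e₂)
    (hc : ∀ n : ℕ, (n : ℂ) • c n = ∑ k ∈ Finset.range (n + 1),
      ((1 : ℂ) ^ k • conifoldGeometric + conifoldPolynomial e₂ e₄ k) * c (n - k) -
        c n * conifoldLog) :
    c 1 0 = ![0, 1, 0, 0] ∧ c 2 0 = ![0, e₂ / 2, 1, 0] := by
  have entry : ∀ (n : ℕ) (i j : Fin 4), (n : ℂ) * c n i j =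
      ∑ k ∈ Finset.range (n + 1), ((((1 : ℂ) ^ k • conifoldGeometric +
        conifoldPolynomial e₂ e₄ k) * c (n - k)) i j) - (c n * conifoldLog) i j := fun n i j => by
    have := congrFun (congrFun (hc n) i) j
    simpa only [Matrix.smul_apply, Matrix.sub_apply, Matrix.sum_apply, smul_eq_mul] using this
  -- The order follows the dependence of the rows: row 1 of `c 1` needs its row 3, and row 0 of `c
  -- 2` needs row 1 of `c 1`.
  have h3 : ∀ j, c 1 3 j = ![0, 0, 0, -e₂] j := by
    have h := fun j => entry 1 3 j
    simp only [Finset.sum_range_succ, Finset.sum_range_zero, Matrix.mul_apply,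
      Fin.sum_univ_four, hc0] at h
    have h0 := h 0
    have h1 := h 1
    have h2 := h 2
    have h3 := h 3
    simp [conifoldGeometric, conifoldPolynomial, conifoldLog, conifoldInitial]
      at h0 h1 h2 h3
    intro j
    fin_cases j <;> simp <;> grind
  have h1 : ∀ j, c 1 1 j = ![0, -(e₂ - 1), -2, 1 - e₂ / 2] j := by
    have h := fun j => entry 1 1 j
    simp only [Finset.sum_range_succ, Finset.sum_range_zero, Matrix.mul_apply,
      Fin.sum_univ_four, hc0] at h
    have h0 := h 0
    have h1 := h 1
    have h2 := h 2
    have h3' := h 3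
    simp [conifoldGeometric, conifoldPolynomial, conifoldLog, conifoldInitial, h3]
      at h0 h1 h2 h3'
    intro j
    fin_cases j <;> simp <;> grind
  have h0 : ∀ j, c 1 0 j = ![0, 1, 0, 0] j := by
    have h := fun j => entry 1 0 j
    simp only [Finset.sum_range_succ, Finset.sum_range_zero, Matrix.mul_apply,
      Fin.sum_univ_four, hc0] at h
    have h0 := h 0
    have h1' := h 1
    have h2 := h 2
    have h3' := h 3
    simp [conifoldGeometric, conifoldPolynomial, conifoldLog, conifoldInitial]
      at h0 h1' h2 h3'
    intro j
    fin_cases j <;> simp <;> grind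
  refine ⟨funext h0, funext ?_⟩
  have h := fun j => entry 2 0 j
  simp only [Finset.sum_range_succ, Finset.sum_range_zero, Matrix.mul_apply,
    Fin.sum_univ_four, hc0] at h
  have k0 := h 0
  have k1 := h 1
  have k2 := h 2
  have k3 := h 3
  simp [conifoldGeometric, conifoldPolynomial, conifoldLog, conifoldInitial, h1]
    at k0 k1 k2 k3
  intro j
  fin_cases j <;> simp <;> grind

end ConifoldSystem

lemma isBigO_sub_taylor_two {g : ℂ → ℂ} {a : ℕ → ℂ} {r : ℝ} (hr : 0 < r)
    (h : ∀ x ∈ Metric.ball (0 : ℂ) r, HasSum (fun k => x ^ k * a k) (g x)) :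
    (fun x => g x - (a 0 + a 1 * x + a 2 * x ^ 2)) =O[𝓝 0] fun x => x ^ 3 := by
  have hp : HasFPowerSeriesAt g (FormalMultilinearSeries.ofScalars ℂ a) 0 := by
    rw [hasFPowerSeriesAt_iff]
    filter_upwards [Metric.ball_mem_nhds (0 : ℂ) hr] with x hx
    simpa [FormalMultilinearSeries.coeff_ofScalars] using h x hx
  have h1 := hp.isBigO_sub_partialSum_pow 3
  refine (h1.congr_left fun x => ?_).trans
    (isBigO_of_le _ fun x => by rw [norm_pow, norm_norm, norm_pow])
  simp [FormalMultilinearSeries.partialSum, Finset.sum_range_succ,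
    FormalMultilinearSeries.coeff_ofScalars]
  ring

lemma exists_isBigO_sub_taylor_two {g : ℂ → ℂ} (hg : AnalyticAt ℂ g 0) :
    ∃ a b c : ℂ, (fun x => g x - (a + b * x + c * x ^ 2)) =O[𝓝 0] fun x => x ^ 3 := by
  obtain ⟨p, hp⟩ := hg
  have h1 := hp.isBigO_sub_partialSum_pow 3
  refine ⟨p.coeff 0, p.coeff 1, p.coeff 2, (h1.congr_left fun x => ?_).trans
    (isBigO_of_le _ fun x => by rw [norm_pow, norm_norm, norm_pow])⟩
  simp [FormalMultilinearSeries.partialSum, Finset.sum_range_succ]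
  ring

/-! ### Existence of the conifold basis and its Gram matrix -/

section ConifoldExistence

attribute [local instance] Matrix.linftyOpNormedRing Matrix.linftyOpNormedAlgebra

variable {X : Data}

lemma ne_zero_of_norm_delta_lt {p : ℂ} (hp : ‖X.delta p‖ < 1) : p ≠ 0 := by
  rintro rfl
  simp [Data.delta] at hp

lemma hasDerivAt_delta (X : Data) (z : ℂ) : HasDerivAt X.delta (-X.mu⁻¹) z :=
  (((hasDerivAt_id z).div_const X.mu).const_sub 1).congr_deriv (by rw [one_div])

/-- The normalized Frobenius basis at the conifold point, together with its jets. -/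
lemma exists_conifold (h : X.IsSelfDual) : ∃ g, X.IsConifoldFrobenius g ∧
    ∀ p ℓ : ℂ, 0 < ‖X.delta p‖ → ‖X.delta p‖ < 1 → Complex.exp ℓ = X.delta p →
      ∃ U, X.IsJetAt U p ∧
        (∀ z, U z 0 = X.conifoldVector g (logBranch (X.delta p) ℓ) z) ∧
        X.jetPairing U U p = conifoldGram X.e₂ := by
  have ha0 : (1 : ℂ) ^ 0 • conifoldGeometric + conifoldPolynomial X.e₂ X.e₄ 0 =
      !![0, 0, 0, 0; 0, 0, 0, -1; 0, 0, 0, X.e₂ - 1; 0, 0, 0, 0] := by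
    ext i j
    fin_cases i <;> fin_cases j <;> simp [conifoldGeometric, conifoldPolynomial] <;> ring
  have hlog : IsNilpotent conifoldLog := ⟨2, conifoldLog_sq⟩
  -- Compatibility with the logarithm forces column 1 of the initial matrix to be the residue
  -- applied to column 3, which fixes the δ² coefficient of ν as e₂ / 2. The entries -1 and 5/2 e₂ -
  -- 3 of column 3 remove the δ and δ² terms of g₃.
  obtain ⟨c, F, hc0, hc, hcF, hFd, hF⟩ := exists_frobenius_solution (r := 1)
    (a := fun k => (1 : ℂ) ^ k • conifoldGeometric + conifoldPolynomial X.e₂ X.e₄ k)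
    (b := conifoldLog) (c₀ := conifoldInitial X.e₂) (A := conifoldSystem X.e₂ X.e₄)
    (by
      rw [ha0]
      refine ⟨2, ?_⟩
      rw [sq]
      ext i j
      rw [Matrix.mul_apply]
      fin_cases i <;> fin_cases j <;> simp [Fin.sum_univ_four])
    hlog
    (by
      rw [ha0]
      ext i j
      rw [Matrix.mul_apply, Matrix.mul_apply]
      fin_cases i <;> fin_cases j <;> simp [Fin.sum_univ_four, conifoldInitial, conifoldLog])
    (fun x hx => hasSum_conifoldSystem X.e₂ X.e₄ hx)
  obtain ⟨hc1, hc2⟩ := conifold_coeff hc0 hc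
  have h0 : (0 : ℂ) ∈ Metric.ball (0 : ℂ) 1 := by simp
  have hF0 : F 0 = conifoldInitial X.e₂ := by
    have h1 := hasSum_single (f := fun k => (0 : ℂ) ^ k • c k) 0 fun k hk => by simp [hk]
    rw [(hcF 0 h0).unique h1]
    simp [hc0]
  set V : ℂ → ℂ → ℂ → Mat := fun p ℓ z =>
    F (X.delta z) * logExp conifoldLog (logBranch (X.delta p) ℓ (X.delta z)) with hV
  set U : ℂ → ℂ → ℂ → Mat := fun p ℓ z => conifoldGauge (X.delta z) * V p ℓ z with hU
  have hjet : ∀ p ℓ : ℂ, 0 < ‖X.delta p‖ → ‖X.delta p‖ < 1 → Complex.exp ℓ = X.delta p →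
      X.IsJetAt (U p ℓ) p := by
    intro p ℓ hp hp1 hℓ
    have hδ0 : X.delta p ≠ 0 := norm_pos_iff.1 hp
    have hδc : ContinuousAt X.delta p := (hasDerivAt_delta X p).continuousAt
    filter_upwards [hδc.eventually (hasDerivAt_logBranch hδ0 ℓ), hδc.eventually_ne hδ0,
      isOpen_ne.mem_nhds (ne_zero_of_norm_delta_lt hp1), hδc.eventually
      (Metric.isOpen_ball.mem_nhds (show X.delta p ∈ Metric.ball (0 : ℂ) 1 by simpa using hp1))]
      with z h1 h2 h3 h4
    have h3 : z ≠ 0 := h3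
    have hδ := hasDerivAt_delta X z
    have hlam : HasDerivAt (fun z => logBranch (X.delta p) ℓ (X.delta z))
        (-X.mu⁻¹ / X.delta z) z := by
      refine (h1.comp z hδ).congr_deriv ?_
      rw [div_eq_mul_inv, mul_comm]
    have hVd := hasDerivAt_mul_logExp conifoldLog_pow_four hFd hF hδ h4 h2 hlam
    have hG : HasDerivAt (fun z => conifoldGauge (X.delta z))
        (-X.mu⁻¹ • conifoldGaugeDeriv (X.delta z)) z :=
      (hasDerivAt_conifoldGauge h2).scomp z hδ
    refine (hG.mul hVd).congr_deriv ?_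
    have hx : z / X.mu = 1 - X.delta z := by simp [Data.delta]
    have hne : 1 - X.delta z ≠ 0 := one_sub_ne_of_mem_ball h4
    have hscal : z⁻¹ * (1 - X.delta z) = X.mu⁻¹ := by
      rw [← hx]
      field_simp
    change (-X.mu⁻¹ • conifoldGaugeDeriv (X.delta z)) * V p ℓ z + conifoldGauge (X.delta z) *
      ((-X.mu⁻¹ / X.delta z) • (conifoldSystem X.e₂ X.e₄ (X.delta z) * V p ℓ z)) =
      z⁻¹ • (companion X.e₂ X.e₄ (z / X.mu) * (conifoldGauge (X.delta z) * V p ℓ z))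
    generalize V p ℓ z = v
    rw [hx, ← mul_assoc (companion _ _ _), ← conifoldGauge_system X.e₂ X.e₄ h2 hne]
    rw [smul_mul_assoc, smul_mul_assoc, smul_smul, mul_neg, hscal, mul_smul_comm, add_mul,
      smul_mul_assoc, smul_add, smul_smul, mul_assoc, ← div_eq_mul_inv]
  have hrow : ∀ p ℓ z : ℂ, U p ℓ z 0 =
      X.conifoldVector (fun j x => F x 0 j) (logBranch (X.delta p) ℓ) z := by
    intro p ℓ z
    have e1 : ∀ M : Mat, (conifoldGauge (X.delta z) * M) 0 = M 0 := fun M => by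
      ext j
      rw [Matrix.mul_apply]
      simp [conifoldGauge, Fin.sum_univ_four]
    simp only [hU, hV, e1, logExp_conifoldLog]
    ext j
    rw [Matrix.mul_apply]
    fin_cases j <;> simp [Data.conifoldVector, Fin.sum_univ_four]
  have hO : ∀ j, (fun x => F x 0 j - (c 0 0 j + c 1 0 j * x + c 2 0 j * x ^ 2)) =O[𝓝 0]
      fun x : ℂ => x ^ 3 := fun j =>
    isBigO_sub_taylor_two (a := fun k => c k 0 j) one_pos fun x hx => by
      simpa using (entryCLM 0 j).hasSum (hcF x hx)
  simp only [hc0, hc1, hc2] at hO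
  refine ⟨fun j x => F x 0 j, ⟨fun j => ?_, ?_, ?_, ?_, ?_, fun p ℓ hp hp1 hℓ i => ?_⟩,
    fun p ℓ hp hp1 hℓ => ⟨U p ℓ, hjet p ℓ hp hp1 hℓ, hrow p ℓ, ?_⟩⟩
  · refine DifferentiableOn.analyticOnNhd (fun z hz => ?_) Metric.isOpen_ball
    exact (hasDerivAt_matrix.1 (hFd.differentiableAt
      (Metric.isOpen_ball.mem_nhds hz)).hasDerivAt 0 j).differentiableAt.differentiableWithinAt
  · simpa [conifoldInitial] using hO 0
  · have h1 : (fun x : ℂ => x ^ 3) =O[𝓝 0] fun x => x ^ 2 :=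
      (isLittleO_pow_pow (by norm_num)).isBigO
    have h2 := ((hO 1).trans h1).add ((isBigO_refl (fun x : ℂ => x ^ 2) _).const_mul_left (X.e₂ / 2))
    refine h2.congr_left fun x => ?_
    simp [conifoldInitial]
    ring
  · simpa [conifoldInitial] using hO 2
  · simpa [conifoldInitial] using hO 3
  · have h1 := (hjet p ℓ hp hp1 hℓ).isSolutionAt h (ne_zero_of_norm_delta_lt hp1)
      (norm_pos_iff.1 hp) i
    simpa only [hrow] using h1
  · have hball : X.delta p ∈ Metric.ball (0 : ℂ) 1 := by simpa using hp1
    have h1 := frobenius_pairing_eq hlog hFd hF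
      (fun x _ => hasDerivAt_conifoldJetForm X.e₂ x)
      (fun x hx => conifoldSystem_form X.e₂ X.e₄ (one_sub_ne_of_mem_ball hx)) hball
    have h2 := conifoldInitial_form X.e₂ (logBranch (X.delta p) ℓ (X.delta p))
    have hx : p / X.mu = 1 - X.delta p := by simp [Data.delta]
    rw [hF0, ← conifoldGauge_form X.e₂ (norm_pos_iff.1 hp)] at h1
    have e : ∀ G Q M E : Mat, (G * (M * E)).transpose * Q * (G * (M * E)) =
        E.transpose * (M.transpose * (G.transpose * Q * G) * M) * E := fun G Q M E => by
      simp only [Matrix.transpose_mul, mul_assoc]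
    change (conifoldGauge _ * (F _ * logExp _ _)).transpose * _ *
      (conifoldGauge _ * (F _ * logExp _ _)) = _
    rw [hx, e, h1, ← h2]
    simp only [Matrix.transpose_mul, mul_assoc]

end ConifoldExistence

/-! ### Uniqueness of the conifold basis -/

section ConifoldUniqueness

variable {X : Data}

/-- The conifold basis in terms of `x = 1 - z / μ` and `l = log x`. -/
def conifoldLocal (g : Fin 4 → ℂ → ℂ) (x l : ℂ) : Fin 4 → ℂ :=
  ![g 0 x, g 1 x, g 2 x, g 1 x * l + g 3 x]

/-- The leading behaviour of the conifold basis, for `l = - s → -∞`. -/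
def conifoldLeading (c : ℂ) (s : ℝ) : Fin 4 → ℂ :=
  ![1, Complex.exp (-s) + c * Complex.exp (-s) ^ 2, Complex.exp (-s) ^ 2,
    -(s * Complex.exp (-s)) - c * (s * Complex.exp (-s) ^ 2)]

lemma differentiableAt_conifoldLocal {g : Fin 4 → ℂ → ℂ} (hg : X.IsConifoldFrobenius g) (i : Fin 4)
    {w : ℂ} (hw : ‖Complex.exp w‖ < 1) :
    DifferentiableAt ℂ (fun w => conifoldLocal g (Complex.exp w) w i) w := by
  have h : ∀ j, DifferentiableAt ℂ (fun w => g j (Complex.exp w)) w := fun j =>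
    (hg.analytic j _ (by simpa using hw)).differentiableAt.comp w Complex.differentiableAt_exp
  have hid : DifferentiableAt ℂ (fun w : ℂ => w) w := differentiableAt_id
  fin_cases i
  · exact h 0
  · exact h 1
  · exact h 2
  · exact ((h 1).fun_mul hid).fun_add (h 3)

/-- The normalization of ν leaves its δ² coefficient open, while the comparison of bases has to be
carried to order δ²; the coefficient is kept as an unknown c. -/
lemma isBigO_one_sub_taylor {g : Fin 4 → ℂ → ℂ} (hg : X.IsConifoldFrobenius g) :
    ∃ c : ℂ, (fun x => g 1 x - (x + c * x ^ 2)) =O[𝓝 0] fun x => x ^ 3 := by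
  obtain ⟨a, b, c, h⟩ := exists_isBigO_sub_taylor_two (hg.analytic 1 0 (by simp))
  have h1 : (fun x : ℂ => a + (b - 1) * x) =O[𝓝 0] fun x => x ^ (1 + 1) := by
    have h32 : (fun x : ℂ => x ^ 3) =O[𝓝 0] fun x => x ^ 2 :=
      (isLittleO_pow_pow (by norm_num)).isBigO
    have h2 := (hg.g_one.sub (h.trans h32)).sub
      ((isBigO_refl (fun x : ℂ => x ^ 2) _).const_mul_left c)
    exact h2.congr_left fun x => by ring
  have ha : a = 0 := by simpa using isBigO_pow_zero h1
  have hb : b = 1 := by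
    have h2 := tendsto_of_isBigO_pow h1 0
    have h3 : b - 1 = 0 := tendsto_nhds_unique (tendsto_const_nhds.congr fun s => by
      have : Complex.exp (-s) * Complex.exp s = 1 := by rw [← Complex.exp_add]; simp
      rw [ha]
      linear_combination -(b - 1) * this) h2
    exact sub_eq_zero.1 h3
  exact ⟨c, by simpa [ha, hb] using h⟩

lemma tendsto_conifoldLocal {g : Fin 4 → ℂ → ℂ} (hg : X.IsConifoldFrobenius g) {c : ℂ}
    (hc : (fun x => g 1 x - (x + c * x ^ 2)) =O[𝓝 0] fun x => x ^ 3) (i : Fin 4) :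
    Tendsto (fun s : ℝ => (conifoldLocal g (Complex.exp (-s)) (-s) i - conifoldLeading c s i) *
      Complex.exp s ^ 2) atTop (𝓝 0) := by
  have t := fun {h : ℂ → ℂ} (hh : h =O[𝓝 0] fun x : ℂ => x ^ (2 + 1)) (k : ℕ) =>
    tendsto_of_isBigO_pow hh k
  fin_cases i
  · exact (t hg.g_zero 0).congr fun s => by simp [conifoldLocal, conifoldLeading]
  · exact (t hc 0).congr fun s => by simp [conifoldLocal, conifoldLeading]
  · exact (t hg.g_two 0).congr fun s => by simp [conifoldLocal, conifoldLeading]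
  · have := ((t hc 1).const_mul (-1)).add (t hg.g_three 0)
    rw [mul_zero, add_zero] at this
    exact this.congr fun s => by simp [conifoldLocal, conifoldLeading]; ring

/-- The functions `1, x, x log x, x², x² log x` are linearly independent modulo `o(x²)`. -/
lemma eq_zero_of_tendsto_scale {a₀ a₁ a₂ a₃ a₄ : ℂ}
    (h : Tendsto (fun s : ℝ => (a₀ + a₁ * Complex.exp (-s) + a₂ * (s * Complex.exp (-s)) +
      a₃ * Complex.exp (-s) ^ 2 + a₄ * (s * Complex.exp (-s) ^ 2)) * Complex.exp s ^ 2)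
      atTop (𝓝 0)) : a₀ = 0 ∧ a₁ = 0 ∧ a₂ = 0 ∧ a₃ = 0 ∧ a₄ = 0 := by
  have e : ∀ s : ℝ, Complex.exp s * Complex.exp (-s) = 1 := fun s => by
    rw [← Complex.exp_add]; simp
  have t0 := tendsto_exp_neg
  have t1 := tendsto_exp_neg_mul_pow 1
  have h0 : a₀ = 0 := by
    have h1 := ((((((h.mul t0).mul t0).sub (t0.const_mul a₁)).sub (t1.const_mul a₂)).sub
      ((t0.mul t0).const_mul a₃)).sub ((t1.mul t0).const_mul a₄))
    simp only [mul_zero, sub_zero] at h1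
    refine tendsto_nhds_unique (tendsto_const_nhds.congr fun s => ?_) h1
    have e1 := e s
    set x := Complex.exp (-s)
    set y := Complex.exp s
    have e2 : y ^ 2 * x * x = 1 := by
      linear_combination (y * x + 1) * e1
    linear_combination -(a₀ + a₁ * x + a₂ * (s * x) + a₃ * x ^ 2 + a₄ * (s * x ^ 2)) * e2
  subst h0
  have h12 : a₁ = 0 ∧ a₂ = 0 ∧ (0 : ℂ) = 0 ∧ (0 : ℂ) = 0 := by
    have h1 := ((h.mul t0).sub (t0.const_mul a₃)).sub (t1.const_mul a₄)
    simp only [mul_zero, sub_zero] at h1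
    refine eq_zero_of_tendsto_cubic (h1.congr fun s => ?_)
    have e1 := e s
    set x := Complex.exp (-s)
    set y := Complex.exp s
    have e2 : y ^ 2 * x * x = 1 := by
      linear_combination (y * x + 1) * e1
    linear_combination (a₁ + a₂ * s + a₃ * x + a₄ * (s * x)) * e2
  obtain ⟨rfl, rfl, -, -⟩ := h12
  have h34 : a₃ = 0 ∧ a₄ = 0 ∧ (0 : ℂ) = 0 ∧ (0 : ℂ) = 0 := by
    refine eq_zero_of_tendsto_cubic (h.congr fun s => ?_)
    have e1 := e s
    set x := Complex.exp (-s)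
    set y := Complex.exp s
    have e2 : y ^ 2 * x * x = 1 := by
      linear_combination (y * x + 1) * e1
    linear_combination (a₃ + a₄ * s) * e2
  exact ⟨rfl, rfl, rfl, h34.1, h34.2.1⟩

/-- As at z = 0, but the four solutions are told apart only modulo o(δ²), in the scale 1, δ, δ log
δ, δ², δ² log δ. Adding a multiple of g₂ to ν is excluded by the logarithmic solution, not by the
normalization of ν. -/
lemma conifold_unique (h : X.IsSelfDual) {g g' : Fin 4 → ℂ → ℂ} (hg : X.IsConifoldFrobenius g)
    (hg' : X.IsConifoldFrobenius g')
    (hbasis : ∀ p ℓ : ℂ, 0 < ‖X.delta p‖ → ‖X.delta p‖ < 1 → Complex.exp ℓ = X.delta p →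
      X.IsSolutionBasisAt (X.conifoldVector g (logBranch (X.delta p) ℓ)) p) :
    ∀ j, Set.EqOn (g' j) (g j) (Metric.ball 0 1) := by
  have hexp : ∀ w : ℂ, w.re < 0 → ‖Complex.exp w‖ < 1 := fun w hw => by
    rw [Complex.norm_exp, Real.exp_lt_one_iff]
    exact hw
  have hδ : ∀ x, X.delta (X.mu * (1 - x)) = x := fun x => by
    have := h.mu_ne
    simp only [Data.delta]
    field_simp
    ring
  obtain ⟨c, hc⟩ := isBigO_one_sub_taylor hg
  obtain ⟨c', hc'⟩ := isBigO_one_sub_taylor hg'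
  have hexpand : ∀ j, ∃ d : Fin 4 → ℂ,
      (∀ w : ℂ, w.re < 0 → conifoldLocal g' (Complex.exp w) w j =
        ∑ i, d i * conifoldLocal g (Complex.exp w) w i) ∧
      Tendsto (fun s : ℝ => (∑ i, d i * conifoldLeading c s i - conifoldLeading c' s j) *
        Complex.exp s ^ 2) atTop (𝓝 0) := by
    intro j
    set p := X.mu * (1 - Complex.exp (-1)) with hp
    have hδp : X.delta p = Complex.exp (-1) := hδ _
    have hp0 : 0 < ‖X.delta p‖ := by
      rw [hδp]; exact norm_pos_iff.2 (Complex.exp_ne_zero _)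
    have hp1 : ‖X.delta p‖ < 1 := by rw [hδp]; exact hexp _ (by simp)
    obtain ⟨d, hd, -⟩ := (hbasis p (-1) hp0 hp1 hδp.symm).2 _
      (hg'.solution p (-1) hp0 hp1 hδp.symm j)
    have hd' : ∀ᶠ w in 𝓝 (-1 : ℂ), conifoldLocal g' (Complex.exp w) w j =
        ∑ i, d i * conifoldLocal g (Complex.exp w) w i := by
      refine eventually_comp_exp (P := fun x l => conifoldLocal g' x l j =
        ∑ i, d i * conifoldLocal g x l i) ?_
      have hcont : ContinuousAt (fun x => X.mu * (1 - x)) (Complex.exp (-1)) := by fun_prop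
      filter_upwards [hcont.eventually hd] with x hx
      simpa only [Data.conifoldVector, conifoldLocal, hδ, hδp] using hx
    have hall : ∀ w : ℂ, w.re < 0 → conifoldLocal g' (Complex.exp w) w j =
        ∑ i, d i * conifoldLocal g (Complex.exp w) w i := fun w hw => eq_sum_on_halfPlane
      (Y := fun w => conifoldLocal g (Complex.exp w) w)
      (fun i w hw => differentiableAt_conifoldLocal hg i (hexp w hw))
      (fun w hw => differentiableAt_conifoldLocal hg' j (hexp w hw)) (by simp) hd' hw
    refine ⟨d, hall, ?_⟩
    have h1 := (tendsto_conifoldLocal hg' hc' j).sub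
      (tendsto_finsetSum Finset.univ fun i _ => (tendsto_conifoldLocal hg hc i).const_mul (d i))
    simp only [mul_zero, Finset.sum_const_zero, sub_zero] at h1
    refine h1.congr' ?_
    filter_upwards [eventually_gt_atTop 0] with s hs
    rw [hall (-(s : ℂ)) (by simpa using hs)]
    simp only [mul_sub, sub_mul, Finset.sum_sub_distrib, Finset.sum_mul, mul_assoc]
    ring
  -- In the fourth component the δ log δ terms force d 3 = 1, and then the δ² log δ terms give c' =
  -- c.
  have hcc : c' = c := by
    obtain ⟨d, -, hd⟩ := hexpand 3
    simp only [Fin.sum_univ_four, conifoldLeading] at hd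
    obtain ⟨e0, e1, e2, e3, e4⟩ := eq_zero_of_tendsto_scale (a₀ := d 0) (a₁ := d 1)
      (a₂ := 1 - d 3) (a₃ := d 1 * c + d 2) (a₄ := c' - d 3 * c)
      (hd.congr fun s => by simp; ring)
    grind
  subst hcc
  have hY : ∀ w : ℂ, w.re < 0 → ∀ j, conifoldLocal g' (Complex.exp w) w j =
      conifoldLocal g (Complex.exp w) w j := by
    intro w hw j
    obtain ⟨d, hall, hd⟩ := hexpand j
    have hd1 : ∀ i, d i = if i = j then 1 else 0 := by
      simp only [Fin.sum_univ_four, conifoldLeading] at hd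
      fin_cases j
      · obtain ⟨e0, e1, e2, e3, e4⟩ := eq_zero_of_tendsto_scale (a₀ := d 0 - 1) (a₁ := d 1)
          (a₂ := -d 3) (a₃ := d 1 * c' + d 2) (a₄ := -d 3 * c') (hd.congr fun s => by simp; ring)
        intro i
        fin_cases i <;> simp <;> grind
      · obtain ⟨e0, e1, e2, e3, e4⟩ := eq_zero_of_tendsto_scale (a₀ := d 0) (a₁ := d 1 - 1)
          (a₂ := -d 3) (a₃ := d 1 * c' + d 2 - c') (a₄ := -d 3 * c')
          (hd.congr fun s => by simp; ring)
        intro i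
        fin_cases i <;> simp <;> grind
      · obtain ⟨e0, e1, e2, e3, e4⟩ := eq_zero_of_tendsto_scale (a₀ := d 0) (a₁ := d 1)
          (a₂ := -d 3) (a₃ := d 1 * c' + d 2 - 1) (a₄ := -d 3 * c')
          (hd.congr fun s => by simp; ring)
        intro i
        fin_cases i <;> simp <;> grind
      · obtain ⟨e0, e1, e2, e3, e4⟩ := eq_zero_of_tendsto_scale (a₀ := d 0) (a₁ := d 1)
          (a₂ := 1 - d 3) (a₃ := d 1 * c' + d 2) (a₄ := c' - d 3 * c')
          (hd.congr fun s => by simp; ring)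
        intro i
        fin_cases i <;> simp <;> grind
    rw [hall w hw]
    simp [hd1]
  have hzero : ∀ {g : Fin 4 → ℂ → ℂ}, X.IsConifoldFrobenius g →
      g 0 0 = 1 ∧ g 1 0 = 0 ∧ g 2 0 = 0 ∧ g 3 0 = 0 := fun {g} hg =>
    ⟨sub_eq_zero.1 (isBigO_pow_zero hg.g_zero), by simpa using isBigO_pow_zero hg.g_one,
      by simpa using isBigO_pow_zero hg.g_two, isBigO_pow_zero hg.g_three⟩
  have hpt : ∀ x ∈ Metric.ball (0 : ℂ) 1, ∀ j, g' j x = g j x := by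
    intro x hx
    rcases eq_or_ne x 0 with rfl | hx0
    · obtain ⟨a0, a1, a2, a3⟩ := hzero hg
      obtain ⟨b0, b1, b2, b3⟩ := hzero hg'
      intro j
      fin_cases j
      exacts [b0.trans a0.symm, b1.trans a1.symm, b2.trans a2.symm, b3.trans a3.symm]
    · have h1 := hY (Complex.log x) (by
        rw [Complex.log_re]
        exact Real.log_neg (norm_pos_iff.2 hx0) (by simpa using hx))
      rw [Complex.exp_log hx0] at h1
      have a0 := h1 0
      have a1 := h1 1
      have a2 := h1 2
      have a3 := h1 3
      simp [conifoldLocal] at a0 a1 a2 a3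
      rw [a1] at a3
      have b3 := add_left_cancel a3
      intro j
      fin_cases j
      exacts [a0, a1, a2, b3]
  exact fun j x hx => hpt x hx j

end ConifoldUniqueness

/-! ### Gram matrices at both ends and the quadratic relation -/

section Transition

attribute [local instance] Matrix.linftyOpNormedRing Matrix.linftyOpNormedAlgebra

variable {X : Data}

lemma isUnit_conifoldGram (e₂ : ℂ) : IsUnit (conifoldGram e₂) := by
  rw [Matrix.isUnit_iff_isUnit_det, isUnit_iff_ne_zero]
  have : (conifoldGram e₂).det = 4 := by
    simp [conifoldGram, Matrix.det_succ_row_zero, Fin.sum_univ_succ, Fin.succAbove]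
    ring
  rw [this]
  norm_num

/-- The form at t = 0 pairs opposite entries. The two contributions of c₂ · D cancel, and ζ(3)χ and
σ meet only zeros or cancel by alternation, so κ alone remains. -/
lemma integralMatrix_form :
    X.integralMatrix * pairing X.e₂ 0 * X.integralMatrix.transpose =
      (-(X.kappa : ℂ) * (2 * Real.pi * Complex.I) ^ 3) • sympl := by
  have hw : (2 * Real.pi * Complex.I : ℂ) ≠ 0 := Complex.two_pi_I_ne_zero
  have e : X.integralMatrix = (2 * Real.pi * Complex.I : ℂ) ^ 3 •
      !![riemannZeta 3 * X.chi / (2 * Real.pi * Complex.I : ℂ) ^ 3,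
          X.c2D / (24 * (2 * Real.pi * Complex.I : ℂ)), 0,
          X.kappa / (2 * Real.pi * Complex.I : ℂ) ^ 3;
        X.c2D / 24, X.sigma / (2 * Real.pi * Complex.I : ℂ),
          -X.kappa / (2 * Real.pi * Complex.I : ℂ) ^ 2, 0;
        1, 0, 0, 0;
        0, 1 / (2 * Real.pi * Complex.I : ℂ), 0, 0] := rfl
  rw [e]
  generalize (2 * Real.pi * Complex.I : ℂ) = w at hw
  generalize riemannZeta 3 = ζ
  ext i j
  simp only [Matrix.mul_apply, Fin.sum_univ_four, Matrix.transpose_apply, Matrix.smul_apply]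
  fin_cases i <;> fin_cases j <;> simp [pairing, sympl] <;> field_simp <;>
    first | ring1 | (ring_nf; simp)

/-- The asserted form is thus κ (2πi)³ times the inverse of the Gram matrix; α enters because 2α =
3/2 (2 - e₂) is its entry between g₀ and the logarithmic solution. -/
lemma conifoldForm_eq (h : X.IsSelfDual) :
    X.conifoldForm * conifoldGram X.e₂ =
      (-(-(X.kappa : ℂ) * (2 * Real.pi * Complex.I) ^ 3)) • (1 : Mat) := by
  have e : X.conifoldForm = (2 * Real.pi * Complex.I : ℂ) ^ 3 •
      !![0, 0, (X.kappa : ℂ) / 2, 0;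
       0, 0, -((X.alpha : ℂ) * X.kappa), -(X.kappa : ℂ);
       -((X.kappa : ℂ) / 2), (X.alpha : ℂ) * X.kappa, 0, 0;
       0, (X.kappa : ℂ), 0, 0] := rfl
  rw [e, h.alpha_eq]
  generalize (2 * Real.pi * Complex.I : ℂ) = w
  ext i j
  simp only [Matrix.mul_apply, Fin.sum_univ_four, Matrix.smul_apply]
  fin_cases i <;> fin_cases j <;> simp [conifoldGram] <;> ring

/-- From the relation for the inverse forms to the quadratic relation. -/
lemma quadratic_of_gram {T S G W : Mat} {s : ℂ} (hs : s ≠ 0) (hS : S * S = -1)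
    (hT : T * W * T.transpose = s • S) (hG : G * W = (-s) • (1 : Mat)) :
    T.transpose * S * T = G := by
  have h1 : T * (W * T.transpose * ((-s⁻¹) • S)) = 1 := by
    rw [← mul_assoc, ← mul_assoc, hT, Matrix.smul_mul, Matrix.mul_smul, smul_smul, hS, smul_neg,
      mul_neg, mul_inv_cancel₀ hs, neg_smul, one_smul, neg_neg]
  -- A right inverse of a square matrix is a left inverse; moving T to the other end produces W (Tᵀ
  -- S T) = -s.
  have h2 := mul_eq_one_comm.1 h1
  have h3 : W * (T.transpose * S * T) = (-s) • (1 : Mat) := by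
    have h4 : (-s⁻¹) • (W * (T.transpose * S * T)) = 1 := by
      rw [← h2]
      simp only [Matrix.mul_smul, Matrix.smul_mul, mul_assoc]
    rw [← h4, smul_smul, neg_mul_neg, mul_inv_cancel₀ hs, one_smul]
  have h5 : (-s) • (T.transpose * S * T) = (-s) • G := by
    calc (-s) • (T.transpose * S * T) = (G * W) * (T.transpose * S * T) := by
          rw [hG, Matrix.smul_mul, one_mul]
      _ = (-s) • G := by rw [mul_assoc, h3, Matrix.mul_smul, mul_one]
  exact smul_right_injective _ (neg_ne_zero.2 hs) h5

lemma sympl_mul_self : sympl * sympl = -1 := by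
  ext i j
  rw [Matrix.mul_apply]
  fin_cases i <;> fin_cases j <;> simp [sympl, Fin.sum_univ_four]

lemma jetPairing_mul (U : ℂ → Mat) (C : Mat) (z : ℂ) :
    X.jetPairing (fun z => U z * C) (fun z => U z * C) z =
      C.transpose * X.jetPairing U U z * C := by
  simp only [Data.jetPairing, Matrix.transpose_mul, mul_assoc]

lemma mulVec_row (T M : Mat) : T.mulVec (M 0) = (M * T.transpose) 0 := by
  ext i
  simp only [Matrix.mulVec, dotProduct, Matrix.mul_apply, Matrix.transpose_apply]
  exact Finset.sum_congr rfl fun j _ => mul_comm _ _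

/-- Two germs of bases of solutions that are continued into each other along a path differ by a
unique matrix, and it is compatible with the invariant forms. -/
lemma exists_transition {p q : ℂ} (γ : Path p q)
    (hγ : ∀ t, γ t ≠ 0 ∧ X.delta (γ t) ≠ 0) {U V : ℂ → Mat} (hU : X.IsJetAt U p)
    (hV : X.IsJetAt V q) (hunit : IsUnit (X.jetPairing V V q)) :
    ∃ T : Mat, (∀ T' : Mat, (∃ F, IsAnalyticContinuation γ F ∧ F 0 =ᶠ[𝓝 p] (fun z => U z 0) ∧
        F 1 =ᶠ[𝓝 q] fun z => T'.mulVec (V z 0)) ↔ T' = T) ∧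
      T * X.jetPairing V V q * T.transpose = X.jetPairing U U p := by
  obtain ⟨F, hF0, hF, hFc⟩ := exists_jet_continuation γ hγ hU
  have hq : q ≠ 0 ∧ X.delta q ≠ 0 := by simpa using hγ 1
  have hF1 : X.IsJetAt (F 1) q := by simpa using hF 1
  obtain ⟨C, hC⟩ := hV.exists_eq_mul hF1 hq.1 hq.2 hunit
  have hcont := isAnalyticContinuation_of_jet hF hFc
  have hrow : ∀ (T' : Mat) (z : ℂ), T'.mulVec (V z 0) = (V z * T'.transpose) 0 :=
    fun T' z => mulVec_row T' (V z)
  -- Solutions stand in the first row of a jet matrix, so T acting on the vector of solutions is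
  -- right multiplication of jets by Tᵀ.
  refine ⟨C.transpose, fun T' => ⟨?_, ?_⟩, ?_⟩
  · rintro ⟨F', hF', h0, h1⟩
    have h2 : F' 1 =ᶠ[𝓝 q] fun z => F 1 z 0 :=
      hF'.eventuallyEq hcont (by rw [hF0]; exact h0)
    have h3 : ∀ i, ∀ᶠ z in 𝓝 q, (V z * T'.transpose) 0 i = (V z * C) 0 i := fun i => by
      filter_upwards [h1, h2, hC] with z h1 h2 h3
      rw [← hrow, ← h1, h2, h3]
    have h4 := ((hV.mul_const _).eventuallyEq_of_row hq.1 (hV.mul_const _) h3).self_of_nhds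
    have h5 : T'.transpose = C := (isUnit_of_isUnit_jetPairing hunit).mul_left_cancel h4
    rw [← h5, Matrix.transpose_transpose]
  · rintro rfl
    refine ⟨_, hcont, by rw [hF0], ?_⟩
    filter_upwards [hC] with z hz
    rw [hrow, Matrix.transpose_transpose, hz]
  · have h1 := jetPairing_continuation γ hγ hF hFc
    rw [hF0] at h1
    rw [← h1, Matrix.transpose_transpose, ← jetPairing_mul]
    simp only [Data.jetPairing, (Filter.Eventually.self_of_nhds hC)]

end Transition

end HypergeometricCY
end

theorem lemma2p1 (X : HypergeometricCY.Data) (hX : X ∈ HypergeometricCY.table) :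
    -- the Frobenius basis at `z = 0` exists
    (∃ f, X.IsMUMFrobenius f) ∧
    -- the normalized Frobenius basis at the conifold exists, is unique, and is a basis
    (∃ g, X.IsConifoldFrobenius g ∧
      ∀ g', X.IsConifoldFrobenius g' → ∀ j, Set.EqOn (g' j) (g j) (Metric.ball 0 1)) ∧
    (∀ g, X.IsConifoldFrobenius g → ∀ p ℓ : ℂ, 0 < ‖X.delta p‖ → ‖X.delta p‖ < 1 →
      Complex.exp ℓ = X.delta p →
      X.IsSolutionBasisAt
        (X.conifoldVector g (HypergeometricCY.logBranch (X.delta p) ℓ)) p) ∧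
    -- for every path and all branches of the logarithms there is exactly one transition matrix,
    -- and it satisfies the quadratic relation
    (∀ f g, X.IsMUMFrobenius f → X.IsConifoldFrobenius g →
      ∀ (p q : ℂ) (γ : Path p q) (ℓ₀ ℓ₁ : ℂ),
        ‖p‖ < ‖X.mu‖ → ‖X.delta q‖ < 1 → (∀ t, γ t ≠ 0 ∧ γ t ≠ X.mu) →
        Complex.exp ℓ₀ = p → Complex.exp ℓ₁ = X.delta q →
        ∃ T : Matrix (Fin 4) (Fin 4) ℂ,
          (∀ T', X.IsTransitionMatrix f g γ ℓ₀ ℓ₁ T' ↔ T' = T) ∧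
          T.transpose * HypergeometricCY.sympl * T = X.conifoldForm) := by
  open HypergeometricCY in
  have h := isSelfDual_of_mem hX
  obtain ⟨f₀, hf₀, hfjet⟩ := exists_mum h
  obtain ⟨g₀, hg₀, hgjet⟩ := exists_conifold h
  have hδ0 : ∀ p : ℂ, ‖p‖ < ‖X.mu‖ → X.delta p ≠ 0 := fun p hp h0 => by
    have h1 : p = X.mu := by
      have := sub_eq_zero.1 h0
      rw [eq_div_iff h.mu_ne] at this
      rw [← this, one_mul]
    exact hp.ne (by rw [h1])
  have hfbasis : ∀ p ℓ : ℂ, 0 < ‖p‖ → ‖p‖ < ‖X.mu‖ → Complex.exp ℓ = p →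
      X.IsSolutionBasisAt (mumVector f₀ (logBranch p ℓ)) p := fun p ℓ hp hp1 hℓ => by
    obtain ⟨U, hU, hrow, hpair⟩ := hfjet p ℓ hp hp1 hℓ
    have h1 := hU.isSolutionBasisAt h (norm_pos_iff.1 hp) (hδ0 p hp1)
      (by rw [hpair]; exact isUnit_pairing _ (by simp))
    simpa only [hrow] using h1
  have hgbasis : ∀ p ℓ : ℂ, 0 < ‖X.delta p‖ → ‖X.delta p‖ < 1 → Complex.exp ℓ = X.delta p →
      X.IsSolutionBasisAt (X.conifoldVector g₀ (logBranch (X.delta p) ℓ)) p :=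
    fun p ℓ hp hp1 hℓ => by
      obtain ⟨U, hU, hrow, hpair⟩ := hgjet p ℓ hp hp1 hℓ
      have h1 := hU.isSolutionBasisAt h (ne_zero_of_norm_delta_lt hp1) (norm_pos_iff.1 hp)
        (by rw [hpair]; exact isUnit_conifoldGram _)
      simpa only [hrow] using h1
  have hguniq := fun g' hg' => conifold_unique (g' := g') h hg₀ hg' hgbasis
  -- The assertions concern arbitrary normalized series, whereas jets and Gram matrices are known
  -- for g₀; uniqueness transfers them.
  have hgnear : ∀ g, X.IsConifoldFrobenius g → ∀ p ℓ : ℂ, ‖X.delta p‖ < 1 →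
      ∀ᶠ z in nhds p, X.conifoldVector g (logBranch (X.delta p) ℓ) z =
        X.conifoldVector g₀ (logBranch (X.delta p) ℓ) z := fun g hg p ℓ hp => by
    have hc : ContinuousAt X.delta p := (hasDerivAt_delta X p).continuousAt
    filter_upwards [hc.eventually
      (Metric.isOpen_ball.mem_nhds (show X.delta p ∈ Metric.ball (0 : ℂ) 1 by simpa using hp))]
      with z hz
    simp only [Data.conifoldVector, hguniq g hg _ hz]
  refine ⟨⟨f₀, hf₀⟩, ⟨g₀, hg₀, hguniq⟩, fun g hg p ℓ hp hp1 hℓ => ?_, ?_⟩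
  · obtain ⟨-, h2⟩ := hgbasis p ℓ hp hp1 hℓ
    refine ⟨hg.solution p ℓ hp hp1 hℓ, fun y hy => ?_⟩
    have hiff : ∀ c : Fin 4 → ℂ,
        (y =ᶠ[nhds p] fun z => ∑ i, c i * X.conifoldVector g (logBranch (X.delta p) ℓ) z i) ↔
        (y =ᶠ[nhds p] fun z => ∑ i, c i * X.conifoldVector g₀ (logBranch (X.delta p) ℓ) z i) :=
      fun c => Filter.eventually_congr ((hgnear g hg p ℓ hp1).mono fun z hz => by simp only [hz])
    simpa only [hiff] using h2 y hy
  · intro f g hf hg p q γ ℓ₀ ℓ₁ hp hq hγ hℓ₀ hℓ₁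
    have hγ' : ∀ t, γ t ≠ 0 ∧ X.delta (γ t) ≠ 0 := fun t => ⟨(hγ t).1, fun h0 => (hγ t).2 (by
      have := sub_eq_zero.1 h0
      rw [eq_div_iff h.mu_ne] at this
      rw [← this, one_mul])⟩
    have hp0 : p ≠ 0 := by simpa using (hγ' 0).1
    have hq0 : X.delta q ≠ 0 := by simpa using (hγ' 1).2
    obtain ⟨U, hU, hUrow, hUpair⟩ := hfjet p ℓ₀ (norm_pos_iff.2 hp0) hp hℓ₀
    obtain ⟨V, hV, hVrow, hVpair⟩ := hgjet q ℓ₁ (norm_pos_iff.2 hq0) hq hℓ₁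
    -- Uniqueness at z = 0 is not asserted, but the quadratic relation is claimed for every
    -- admissible f, so it is needed here.
    have hfeq := mum_unique h hf₀ hf hfbasis
    have hfnear : ∀ᶠ z in nhds p, X.integralVector f (logBranch p ℓ₀) z =
        (U z * X.integralMatrix.transpose) 0 := by
      filter_upwards [Metric.isOpen_ball.mem_nhds
        (show p ∈ Metric.ball (0 : ℂ) ‖X.mu‖ by simpa using hp)] with z hz
      have h1 : mumVector f (logBranch p ℓ₀) z = U z 0 := by
        rw [hUrow]
        simp only [mumVector, hfeq _ hz]
      rw [Data.integralVector, h1]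
      exact mulVec_row _ _
    obtain ⟨T, hT, hTpair⟩ := exists_transition γ hγ' (hU.mul_const X.integralMatrix.transpose) hV
      (by rw [hVpair]; exact isUnit_conifoldGram _)
    refine ⟨T, fun T' => ?_, ?_⟩
    · rw [← hT T']
      refine exists_congr fun F => and_congr_right fun _ => and_congr ?_ ?_
      · exact Filter.eventually_congr (hfnear.mono fun z hz => by simp only [hz])
      · exact Filter.eventually_congr ((hgnear g hg q ℓ₁ hq).mono fun z hz => by
          simp only [hz, ← hVrow])
    · rw [jetPairing_mul, hUpair, hVpair, Matrix.transpose_transpose, integralMatrix_form]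
        at hTpair
      refine quadratic_of_gram ?_ sympl_mul_self hTpair (conifoldForm_eq h)
      exact mul_ne_zero (neg_ne_zero.2 (by exact_mod_cast h.kappa_ne))
        (pow_ne_zero 3 Complex.two_pi_I_ne_zero)
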